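/- Let $(s_i)$ be a stationary, time-invariant, first-order Markov chain on a discrete (countable) alphabet $\mathcal S$ with $H(s_0)<\infty$, and assume that the source is symmetric (reversible): $(s_0,\dots,s_l)$ and $(s_l,\dots,s_0)$ have the same law for every $l\ge 0$. Let $B,W\ge 0$ be integers. For a block length $n$ and a horizon $\mathcal L$, let $s_{-1}^n,s_0^n,\dots,s_{\mathcal L}^n$ be the source sequences formed by $n$ independent copies of the chain. A rate-$R$ code with memoryless encoders consists, for each time $0\le i\le\mathcal L$, of an encoder $f_i=\mathcal F_i(s_i^n)$ whose values are integers in $[1,2^{nR}]$, and of a decoder $\hat s_i^n=\mathcal G_i(g_0,\dots,g_i,s_{-1}^n)$. Here the channel outputs are $g_i=\star$ for $i\in\{j,\dots,j+B'-1\}$ and $g_i=f_i$ otherwise, for a burst erasure with start $j\ge 0$ and length $B'\le B$ that are unknown to the encoder. A rate $R\ge 0$ is feasible for horizon $\mathcal L$ if there are a sequence of such codes, indexed by $n$, and a sequence $\varepsilon_n\to 0$ with $\Pr(\hat s_i^n\ne s_i^n)\le\varepsilon_n$ for all $n$, all $j\ge 0$, all $B'\le B$ and all $0\le i\le\mathcal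 L$ with $i\notin\{j,\dots,j+B'+W-1\}$. Let $R_{\mathcal L}(B,W)$ be the infimum of the feasible rates. Then the lossless rate-recovery function restricted to memoryless encoders, $R(B,W)=\lim_{\mathcal L\to\infty}R_{\mathcal L}(B,W)$, exists and equals $$R(B,W)=\frac{1}{W+1}\,H(s_{B+1},s_{B+2},\dots,s_{B+W+1}\mid s_0),$$ where entropies are measured in bits. -/

import Mathlib

open Filter Topology
open scoped ENNReal NNReal

noncomputable section

namespace Streaming

/-! ### Entropies of discrete laws, in bits -/

/-- The entropy `H(X)`, in bits, of a discrete random variable with law `p`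
(all terms are nonnegative, the value is `∞` if the series diverges). -/
def entropy {α : Type*} (p : PMF α) : ℝ≥0∞ :=
  ∑' a, ENNReal.ofReal (-((p a).toReal * Real.logb 2 (p a).toReal))

/-- The conditional entropy `H(Y | X)`, in bits, where `q` is the joint law of `(X, Y)`:
the sum over `(x, y)` of `- q(x, y) log₂ (q(x, y) / q_X(x))` (all terms are nonnegative). -/
def condEntropy {α β : Type*} (q : PMF (α × β)) : ℝ≥0∞ :=
  ∑' z, ENNReal.ofReal
    (-((q z).toReal * Real.logb 2 ((q z).toReal / (q.map Prod.fst z.1).toReal)))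

/-! ### Laws of independent copies and of Markov paths -/

theorem tsum_prod_pi_eq_one {α : Type*} (q : PMF α) (n : ℕ) :
    ∑' x : Fin n → α, ∏ k, q (x k) = 1 := by
  induction n with
  | zero => simp
  | succ n ih =>
    rw [← (Fin.consEquiv (fun _ : Fin (n + 1) => α)).tsum_eq, ENNReal.tsum_prod']
    simp [Fin.prod_univ_succ, Fin.consEquiv, ENNReal.tsum_mul_left, ih, q.tsum_coe]

/-- The law of `n` independent copies of a random variable with law `q`. -/
def iidLaw {α : Type*} (q : PMF α) (n : ℕ) : PMF (Fin n → α) :=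
  ⟨fun x => ∏ k, q (x k), by
    rw [← tsum_prod_pi_eq_one q n]; exact ENNReal.summable.hasSum⟩

/-- A stationary, time-invariant, first-order Markov source over the discrete alphabet `S`:
a marginal law and a transition law `trans a = p₁(· | a)` that leaves the marginal invariant. -/
structure MarkovSource (S : Type*) where
  marg : PMF S
  trans : S → PMF S
  stationary : marg.bind trans = marg

namespace MarkovSource

variable {S : Type*}

theorem tsum_path_eq_one (P : MarkovSource S) (l : ℕ) :
    ∑' x : Fin (l + 1) → S,
      P.marg (x 0) * ∏ i : Fin l, P.trans (x i.castSucc) (x i.succ) = 1 := by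
  have key : ∀ (l : ℕ) (p : PMF S), ∑' x : Fin (l + 1) → S,
      p (x 0) * ∏ i : Fin l, P.trans (x i.castSucc) (x i.succ) = 1 := by
    intro l
    induction l with
    | zero =>
      intro p
      rw [← (Equiv.funUnique (Fin 1) S).symm.tsum_eq]
      simp [p.tsum_coe]
    | succ l ih =>
      intro p
      rw [← (Fin.consEquiv (fun _ : Fin (l + 2) => S)).tsum_eq, ENNReal.tsum_prod']
      have h : ∀ a : S, ∀ y : Fin (l + 1) → S,
          p ((Fin.consEquiv (fun _ : Fin (l + 2) => S)) (a, y) 0) *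
            ∏ i : Fin (l + 1),
              P.trans ((Fin.consEquiv (fun _ : Fin (l + 2) => S)) (a, y) i.castSucc)
                ((Fin.consEquiv (fun _ : Fin (l + 2) => S)) (a, y) i.succ) =
          p a * (P.trans a (y 0) *
            ∏ i : Fin l, P.trans (y i.castSucc) (y i.succ)) := by
        intro a y
        simp [Fin.consEquiv, Fin.prod_univ_succ]
      simp_rw [h, ENNReal.tsum_mul_left, ih]
      simp [p.tsum_coe]
  exact key l P.marg

/-- The joint law of `l + 1` consecutive source symbols. -/
def pathLaw (P : MarkovSource S) (l : ℕ) : PMF (Fin (l + 1) → S) :=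
  ⟨fun x => P.marg (x 0) * ∏ i : Fin l, P.trans (x i.castSucc) (x i.succ), by
    rw [← P.tsum_path_eq_one l]; exact ENNReal.summable.hasSum⟩

/-- A symmetric source: the Markov chain is reversible, i.e. `(s_0, …, s_l)` and
`(s_l, …, s_0)` have the same law for every `l`. -/
def IsSymmetric (P : MarkovSource S) : Prop :=
  ∀ l : ℕ, (P.pathLaw l).map (fun x => x ∘ Fin.rev) = P.pathLaw l

/-- The joint law of `s_0` and of the window `(s_{B+1}, …, s_{B+W+1})`. -/
def windowLaw (P : MarkovSource S) (B W : ℕ) : PMF (S × (Fin (W + 1) → S)) :=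
  (P.pathLaw (B + W + 1)).map
    (fun x => (x 0, fun t : Fin (W + 1) => x ⟨B + 1 + (t : ℕ), by omega⟩))

/-- The law of the source sequences `s_{-1}^n, s_0^n, …, s_L^n`: the outcome `ω` consists of
`n` independent paths of the Markov chain, and `ω k t` is the `k`-th symbol of `s_{t-1}^n`. -/
def blockLaw (P : MarkovSource S) (n L : ℕ) : PMF (Fin n → Fin (L + 2) → S) :=
  iidLaw (P.pathLaw (L + 1)) n

end MarkovSource

/-- The index set `[1, 2^{nR}]` has `⌊2^{nR}⌋` elements. -/
def numMessages (n : ℕ) (R : ℝ≥0) : ℕ := ⌊(2 : ℝ) ^ ((n : ℝ) * (R : ℝ))⌋₊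

/-- The sequence `s_{t-1}^n` in the outcome `ω`. -/
def block {S : Type*} {n L : ℕ} (ω : Fin n → Fin (L + 2) → S) (t : Fin (L + 2)) : Fin n → S :=
  fun k => ω k t

/-- A streaming code of block length `n`, horizon `L` and `M` messages. At time `i` the encoder
maps `(s_{-1}^n, …, s_i^n)` to an index, and the decoder maps the channel outputs
`g_0, …, g_i` (where `none` is the erasure symbol) and `s_{-1}^n` to a reconstruction. -/
structure Code (S : Type*) (n L M : ℕ) where
  enc : (i : Fin (L + 1)) → (Fin (i + 2) → Fin n → S) → Fin M
  dec : (i : Fin (L + 1)) → (Fin (i + 1) → Option (Fin M)) → (Fin n → S) → (Fin n → S)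

namespace Code

variable {S : Type*} {n L M : ℕ}

/-- The encoder is memoryless: at each time `i` its output is a function of `s_i^n` alone. -/
def IsMemoryless (c : Code S n L M) : Prop :=
  ∀ i : Fin (L + 1), ∃ F : (Fin n → S) → Fin M,
    ∀ past : Fin (i + 2) → Fin n → S, c.enc i past = F (past (Fin.last (i + 1)))

/-- The channel input `f_i`. -/
def channelInput (c : Code S n L M) (ω : Fin n → Fin (L + 2) → S) (i : Fin (L + 1)) : Fin M :=
  c.enc i (fun t => block ω ⟨(t : ℕ), by omega⟩)

/-- The channel output `g_i` when the burst erasure occupies `{j, …, j + b - 1}`. -/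
def channelOutput (c : Code S n L M) (j b : ℕ) (ω : Fin n → Fin (L + 2) → S)
    (i : Fin (L + 1)) : Option (Fin M) :=
  if j ≤ (i : ℕ) ∧ (i : ℕ) < j + b then none else some (c.channelInput ω i)

/-- The reconstruction of `s_i^n` when the burst erasure occupies `{j, …, j + b - 1}`. -/
def reconstruction (c : Code S n L M) (j b : ℕ) (ω : Fin n → Fin (L + 2) → S)
    (i : Fin (L + 1)) : Fin n → S :=
  c.dec i (fun t => c.channelOutput j b ω ⟨(t : ℕ), by omega⟩) (block ω 0)

/-- The probability that `s_i^n` is not reconstructed correctly. -/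
def errorProb (P : MarkovSource S) (c : Code S n L M) (j b : ℕ) (i : Fin (L + 1)) : ℝ≥0∞ :=
  (P.blockLaw n L).toOuterMeasure {ω | c.reconstruction j b ω i ≠ block ω i.succ}

end Code

/-- The rate `R` is feasible, with memoryless encoders, for horizon `L`, maximal burst length `B`
and recovery window `W`: for some sequence of codes the error probability vanishes as `n → ∞`,
for each burst start `j` and burst length `b ≤ B` and each time `i` outside of
`{j, …, j + b + W - 1}`. -/
def MemorylessFeasible {S : Type*} (P : MarkovSource S) (L B W : ℕ) (R : ℝ≥0) : Prop :=
  ∃ (c : (n : ℕ) → Code S n L (numMessages n R)) (ε : ℕ → ℝ≥0∞),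
    (∀ n, (c n).IsMemoryless) ∧ Tendsto ε atTop (𝓝 0) ∧
    ∀ (n j b : ℕ), b ≤ B → ∀ i : Fin (L + 1), ¬ (j ≤ (i : ℕ) ∧ (i : ℕ) < j + b + W) →
      (c n).errorProb P j b i ≤ ε n

/-- The lossless rate-recovery function for horizon `L`, restricted to memoryless encoders:
the infimum of the feasible rates. -/
def memorylessRate {S : Type*} (P : MarkovSource S) (L B W : ℕ) : ℝ≥0∞ :=
  ⨅ (R : ℝ≥0) (_ : MemorylessFeasible P L B W R), (R : ℝ≥0∞)

end Streaming

end

/-! For every horizon `L ≥ B + W` the optimal rate already equals the claimed value, so the limit is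
that of an eventually constant sequence. By the chain rule and stationarity the window entropy is
`H(s_{B+1} | s_0) + W H(s_1 | s_0)` (`condEntropy_windowLaw`).

Converse (`one_le_of_errorProb_le`). Erase times `0, …, B-1`. At time `B + W` the decoder finds
`s_{B+W}` from `s_{-1}` and the `W + 1` indices `f_B, …, f_{B+W}`. Without erasures, `s_i` can be
estimated from `s_{i-1}` and `f_i`, by the Markov property and because encoders are memoryless; by
reversibility the same estimator finds `s_i` from `s_{i+1}` and `f_i`. Going backwards from
`s_{B+W}`, the same `W + 1` indices determine the whole window. Given `s_{-1}`, at most `M ^ (W +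
1)` windows are thus decodable, while the law of large numbers spreads the conditional law over
about `2^{nH}` windows, `H` being the window entropy. This count plays the role of Fano's
inequality.

Achievability (`exists_binningCode`). Each `s_i^n` is sent as a random bin index, and the decoder
picks a typical sequence in the received bins. A wrong successor of a known symbol is excluded if `R
> H(s_1 | s_0)`. After a burst, a candidate that agrees with the source somewhere in the recovery
window agrees from there on, so only windows that are wrong everywhere matter. Each such window
collides with probability at most `M⁻¹ ^ (W + 1)`, so `(W + 1) R` above the window entropy suffices.
This also implies the first condition, since `H(s_m | s_0)` increases with `m`. -/

noncomputable section

namespace Streaming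

variable {α β γ S : Type*}

/-! ### Discrete laws -/

/-- The law of a pair whose first component has law `p` and whose second component has the
conditional law `κ`. -/
def joint (p : PMF α) (κ : α → PMF β) : PMF (α × β) :=
  p.bind fun a => (κ a).map (Prod.mk a)

theorem joint_apply (p : PMF α) (κ : α → PMF β) (z : α × β) :
    joint p κ z = p z.1 * κ z.1 z.2 := by
  classical
  obtain ⟨a, b⟩ := z
  rw [joint, PMF.bind_apply, tsum_eq_single a]
  · rw [PMF.map_apply, tsum_eq_single b]
    · simp
    · intro b' hb
      simp [hb.symm]
  · intro a' ha
    rw [PMF.map_apply]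
    simp [ha.symm]

theorem map_fst_joint (p : PMF α) (κ : α → PMF β) : (joint p κ).map Prod.fst = p := by
  simp only [joint, PMF.map_bind, PMF.map_comp]
  conv_rhs => rw [← p.bind_pure]
  congr 1
  funext a
  exact (κ a).map_const a

theorem map_snd_joint (p : PMF α) (κ : α → PMF β) : (joint p κ).map Prod.snd = p.bind κ := by
  simp only [joint, PMF.map_bind, PMF.map_comp]
  congr 1
  funext a
  exact (κ a).map_id

theorem joint_toOuterMeasure (p : PMF α) (κ : α → PMF β) (s : Set (α × β)) :
    (joint p κ).toOuterMeasure s = ∑' a, p a * (κ a).toOuterMeasure {b | (a, b) ∈ s} := by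
  simp only [joint, PMF.toOuterMeasure_bind_apply, PMF.toOuterMeasure_map_apply]
  rfl

theorem map_equiv_apply (e : α ≃ β) (p : PMF α) (b : β) : p.map e b = p (e.symm b) := by
  classical
  rw [PMF.map_apply, tsum_eq_single (e.symm b)]
  · simp
  · intro a ha
    rw [if_neg]
    rintro rfl
    simp at ha

theorem tsum_pi_prod {n : ℕ} (f : Fin n → α → ℝ≥0∞) :
    ∑' x : Fin n → α, ∏ k, f k (x k) = ∏ k, ∑' a, f k a := by
  induction n with
  | zero => simp
  | succ n ih =>
    rw [← (Fin.consEquiv (fun _ : Fin (n + 1) => α)).tsum_eq, ENNReal.tsum_prod']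
    simp only [Fin.consEquiv, Equiv.coe_fn_mk, Fin.prod_univ_succ, Fin.cons_zero, Fin.cons_succ,
      ENNReal.tsum_mul_left, ENNReal.tsum_mul_right]
    rw [ih (fun k => f k.succ)]

/-- The law of independent random variables with laws `q k`. -/
def prodLaw {n : ℕ} (q : Fin n → PMF α) : PMF (Fin n → α) :=
  ⟨fun x => ∏ k, q k (x k), by
    have h : ∑' x : Fin n → α, ∏ k, q k (x k) = 1 := by
      rw [tsum_pi_prod (fun k a => q k a)]
      simp [PMF.tsum_coe]
    rw [← h]; exact ENNReal.summable.hasSum⟩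

theorem prodLaw_apply {n : ℕ} (q : Fin n → PMF α) (x : Fin n → α) :
    prodLaw q x = ∏ k, q k (x k) := rfl

theorem iidLaw_apply (q : PMF α) (n : ℕ) (x : Fin n → α) : iidLaw q n x = ∏ k, q (x k) := rfl

theorem iidLaw_map (q : PMF α) (n : ℕ) (g : α → β) :
    (iidLaw q n).map (fun x k => g (x k)) = iidLaw (q.map g) n := by
  classical
  ext y
  simp only [PMF.map_apply, iidLaw_apply]
  rw [← tsum_pi_prod (fun k a => if y k = g a then q a else 0)]
  refine tsum_congr fun x => ?_
  rw [Finset.prod_ite_zero]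
  simp [funext_iff]

theorem iidLaw_joint (p : PMF α) (κ : α → PMF β) (n : ℕ) :
    (iidLaw (joint p κ) n).map (fun z => (fun k => (z k).1, fun k => (z k).2)) =
      joint (iidLaw p n) (fun x => prodLaw fun k => κ (x k)) := by
  ext z
  have := map_equiv_apply (Equiv.arrowProdEquivProdArrow (Fin n) (fun _ => α) (fun _ => β))
    (iidLaw (joint p κ) n) z
  refine this.trans ?_
  simp [joint_apply, iidLaw_apply, prodLaw_apply, Finset.prod_mul_distrib,
    Equiv.arrowProdEquivProdArrow]

/-! ### Paths of a Markov chain -/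

namespace MarkovSource

/-- The law of a path of `l + 1` symbols of the chain whose first symbol has law `p`. -/
def pathFrom (P : MarkovSource S) (p : PMF S) : (l : ℕ) → PMF (Fin (l + 1) → S)
  | 0 => p.map fun a _ => a
  | l + 1 => (joint p fun a => pathFrom P (P.trans a) l).map
      (Fin.consEquiv (fun _ : Fin (l + 2) => S))

theorem pathFrom_apply (P : MarkovSource S) (p : PMF S) (l : ℕ) (x : Fin (l + 1) → S) :
    P.pathFrom p l x = p (x 0) * ∏ i : Fin l, P.trans (x i.castSucc) (x i.succ) := by
  induction l generalizing p with
  | zero =>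
    refine (map_equiv_apply (Equiv.funUnique (Fin 1) S).symm p x).trans ?_
    simp
  | succ l ih =>
    rw [pathFrom, map_equiv_apply, joint_apply, ih]
    simp [Fin.consEquiv, Fin.prod_univ_succ, Fin.tail]

theorem pathLaw_eq (P : MarkovSource S) (l : ℕ) : P.pathLaw l = P.pathFrom P.marg l := by
  ext x
  rw [pathFrom_apply]
  rfl

theorem pathFrom_bind (P : MarkovSource S) (p : PMF α) (κ : α → PMF S) (l : ℕ) :
    P.pathFrom (p.bind κ) l = p.bind fun a => P.pathFrom (κ a) l := by
  ext x
  simp only [pathFrom_apply, PMF.bind_apply, ← ENNReal.tsum_mul_right, mul_assoc]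

/-- `pathFrom` is defined by splitting off the first symbol; splitting off the last one gives the
Markov property in the form used for decoding. -/
theorem pathFrom_succ_eq_snoc (P : MarkovSource S) (p : PMF S) (l : ℕ) :
    (P.pathFrom p (l + 1)).map (fun x => ((Fin.init x : Fin (l + 1) → S), x (Fin.last (l + 1)))) =
      joint (P.pathFrom p l) (fun x => P.trans (x (Fin.last l))) := by
  ext z
  have := map_equiv_apply ((Fin.snocEquiv (fun _ : Fin (l + 2) => S)).symm.trans
    (Equiv.prodComm _ _)) (P.pathFrom p (l + 1)) z
  refine Eq.trans ?_ (this.trans ?_)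
  · rfl
  · obtain ⟨x, a⟩ := z
    rw [joint_apply, pathFrom_apply, pathFrom_apply, Fin.prod_univ_castSucc, ← mul_assoc]
    have h0 : (Fin.snoc x a : Fin (l + 2) → S) 0 = x 0 := by
      rw [show (0 : Fin (l + 2)) = Fin.castSucc 0 from rfl, Fin.snoc_castSucc]
    have hs : ∀ i : Fin l, (Fin.snoc x a : Fin (l + 2) → S) i.castSucc.succ = x i.succ := by
      intro i
      rw [Fin.succ_castSucc, Fin.snoc_castSucc]
    simp [Fin.snocEquiv, h0, hs]

theorem pathFrom_map_init (P : MarkovSource S) (p : PMF S) (l : ℕ) :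
    (P.pathFrom p (l + 1)).map (fun x => (Fin.init x : Fin (l + 1) → S)) = P.pathFrom p l := by
  have h := congrArg (PMF.map Prod.fst) (P.pathFrom_succ_eq_snoc p l)
  rwa [map_fst_joint, PMF.map_comp] at h

theorem pathFrom_map_tail (P : MarkovSource S) (p : PMF S) (l : ℕ) :
    (P.pathFrom p (l + 1)).map (fun x => (Fin.tail x : Fin (l + 1) → S)) =
      P.pathFrom (p.bind P.trans) l := by
  rw [pathFrom, PMF.map_comp, pathFrom_bind, ← map_snd_joint]
  rfl

/-- The law of the symbol at time `t`, if the symbol at time `0` has law `p`. -/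
def advance (P : MarkovSource S) (p : PMF S) : ℕ → PMF S
  | 0 => p
  | t + 1 => advance P (p.bind P.trans) t

/-- The `m`-step transition law. -/
def step (P : MarkovSource S) (m : ℕ) (a : S) : PMF S := P.advance (PMF.pure a) m

theorem advance_marg (P : MarkovSource S) (t : ℕ) : P.advance P.marg t = P.marg := by
  induction t with
  | zero => rfl
  | succ t ih => rw [advance, P.stationary, ih]

theorem advance_bind (P : MarkovSource S) (p : PMF α) (κ : α → PMF S) (t : ℕ) :
    P.advance (p.bind κ) t = p.bind fun a => P.advance (κ a) t := by
  induction t generalizing κ with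
  | zero => rfl
  | succ t ih =>
    simp only [advance, PMF.bind_bind]
    exact ih _

theorem advance_eq_bind_step (P : MarkovSource S) (p : PMF S) (m : ℕ) :
    P.advance p m = p.bind (P.step m) := by
  conv_lhs => rw [← p.bind_pure, advance_bind]
  rfl

theorem marg_bind_step (P : MarkovSource S) (m : ℕ) : P.marg.bind (P.step m) = P.marg := by
  rw [← advance_eq_bind_step, advance_marg]

theorem step_one (P : MarkovSource S) (a : S) : P.step 1 a = P.trans a := by
  simp [step, advance]

theorem step_succ (P : MarkovSource S) (m : ℕ) (a : S) :
    P.step (m + 1) a = (P.trans a).bind (P.step m) := by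
  rw [← advance_eq_bind_step]
  simp [step, advance]

theorem pathFrom_map_window (P : MarkovSource S) (p : PMF S) (t W N : ℕ) (h : t + W ≤ N) :
    (P.pathFrom p N).map (fun x (u : Fin (W + 1)) => x ⟨t + u, by omega⟩) =
      P.pathFrom (P.advance p t) W := by
  induction t generalizing p N with
  | zero =>
    simp only [advance]
    induction N with
    | zero =>
      obtain rfl : W = 0 := by omega
      convert PMF.map_id _
      simp [Fin.fin_one_eq_zero]
    | succ N ih =>
      rcases (show W = N + 1 ∨ W ≤ N by omega) with rfl | hW
      · convert PMF.map_id _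
        simp
      · rw [← ih (by omega), ← P.pathFrom_map_init p N, PMF.map_comp]
        rfl
  | succ t ih =>
    obtain ⟨N, rfl⟩ : ∃ N', N = N' + 1 := ⟨N - 1, by omega⟩
    rw [advance, ← ih _ N (by omega), ← pathFrom_map_tail, PMF.map_comp]
    congr 1
    funext x u
    simp only [Function.comp, Fin.tail]
    congr 1
    ext
    simp
    omega

theorem pathLaw_map_window (P : MarkovSource S) (t W N : ℕ) (h : t + W ≤ N) :
    (P.pathLaw N).map (fun x (u : Fin (W + 1)) => x ⟨t + u, by omega⟩) = P.pathLaw W := by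
  rw [pathLaw_eq, pathLaw_eq, pathFrom_map_window _ _ _ _ _ h, advance_marg]

theorem windowLaw_eq_joint (P : MarkovSource S) (B W : ℕ) :
    P.windowLaw B W = joint P.marg (fun a => P.pathFrom (P.step (B + 1) a) W) := by
  rw [windowLaw, pathLaw_eq, pathFrom, PMF.map_comp, joint, PMF.map_bind, joint]
  congr 1
  funext a
  rw [show P.step (B + 1) a = P.advance (P.trans a) B by simp [step, advance],
    ← P.pathFrom_map_window (P.trans a) B W (B + W) le_rfl, PMF.map_comp, PMF.map_comp]
  congr 1
  ext x u
  · simp [Fin.consEquiv]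
  · simp only [Function.comp, Fin.consEquiv, Equiv.coe_fn_mk]
    have : (⟨B + 1 + (u : ℕ), by omega⟩ : Fin (B + W + 2)) =
      Fin.succ ⟨B + u, by omega⟩ := by ext; simp; omega
    rw [this, Fin.cons_succ]

/-- The law of a symbol and of a window of later symbols. -/
theorem pathLaw_map_window_pair (P : MarkovSource S) (t B W N : ℕ) (h : t + B + W + 1 ≤ N) :
    (P.pathLaw N).map (fun x => (x ⟨t, by omega⟩,
      fun u : Fin (W + 1) => x ⟨t + B + 1 + u, by omega⟩)) = P.windowLaw B W := by
  rw [windowLaw, ← P.pathLaw_map_window t (B + W + 1) N (by omega), PMF.map_comp]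
  congr 1
  ext x u
  · simp
  · simp only [Function.comp]
    congr 2
    omega

/-- The law of two symbols at distance `m`. -/
theorem pathLaw_map_pair (P : MarkovSource S) (t m N : ℕ) (hm : 1 ≤ m) (h : t + m ≤ N) :
    (P.pathLaw N).map (fun x => (x ⟨t, by omega⟩, x ⟨t + m, by omega⟩)) =
      joint P.marg (P.step m) := by
  obtain ⟨m, rfl⟩ : ∃ m', m = m' + 1 := ⟨m - 1, by omega⟩
  have h1 := congrArg (PMF.map (Prod.map id fun y : Fin 1 → S => y 0))
    ((P.pathLaw_map_window_pair t m 0 N (by omega)).trans (P.windowLaw_eq_joint m 0))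
  rw [PMF.map_comp] at h1
  refine Eq.trans ?_ (h1.trans ?_)
  · rfl
  · simp only [joint, PMF.map_bind, PMF.map_comp]
    congr 1
    funext a
    simp only [pathFrom, PMF.map_comp]
    rfl

theorem pathLaw_map_past (P : MarkovSource S) (t N : ℕ) (h : t + 1 ≤ N) :
    (P.pathLaw N).map (fun x => ((fun u : Fin (t + 1) => x ⟨u, by omega⟩), x ⟨t + 1, by omega⟩)) =
      joint (P.pathLaw t) (fun x => P.trans (x (Fin.last t))) := by
  rw [pathLaw_eq P t, ← pathFrom_succ_eq_snoc, ← pathLaw_eq,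
    ← P.pathLaw_map_window 0 (t + 1) N (by omega), PMF.map_comp]
  congr 1
  ext x u
  · simp [Fin.init]
  · simp

/-- Reversal of two adjacent symbols is all that the converse takes from symmetry. -/
theorem IsSymmetric.swap {P : MarkovSource S} (h : P.IsSymmetric) :
    (joint P.marg P.trans).map Prod.swap = joint P.marg P.trans := by
  have e : (P.pathLaw 1).map (fun x => (x 0, x 1)) = joint P.marg P.trans := by
    have := P.pathLaw_map_pair 0 1 1 le_rfl le_rfl
    rw [funext P.step_one] at this
    exact this
  rw [← e, PMF.map_comp]
  conv_rhs => rw [← h 1, PMF.map_comp]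
  rfl

end MarkovSource

/-! ### Entropies -/

theorem condEntropy_joint (p : PMF α) (κ : α → PMF β) :
    condEntropy (joint p κ) = ∑' a, p a * entropy (κ a) := by
  rw [condEntropy, ENNReal.tsum_prod', map_fst_joint]
  refine tsum_congr fun a => ?_
  rw [entropy, ← ENNReal.tsum_mul_left]
  refine tsum_congr fun b => ?_
  rw [joint_apply]
  rcases eq_or_ne (p a) 0 with h | h
  · simp [h]
  · have h' : (p a).toReal ≠ 0 := (ENNReal.toReal_pos h (p.apply_ne_top a)).ne'
    rw [ENNReal.toReal_mul, mul_div_cancel_left₀ _ h', mul_assoc, ← mul_neg,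
      ENNReal.ofReal_mul ENNReal.toReal_nonneg, ENNReal.ofReal_toReal (p.apply_ne_top a)]

theorem neg_logb_toReal_nonneg (p : PMF α) (a : α) : 0 ≤ -Real.logb 2 (p a).toReal := by
  rw [neg_nonneg]
  exact Real.logb_nonpos one_lt_two ENNReal.toReal_nonneg
    (by simpa using ENNReal.toReal_mono ENNReal.one_ne_top (p.coe_le_one a))

theorem entropy_eq (p : PMF α) :
    entropy p = ∑' a, p a * ENNReal.ofReal (-Real.logb 2 (p a).toReal) := by
  refine tsum_congr fun a => ?_
  rw [← mul_neg, ENNReal.ofReal_mul ENNReal.toReal_nonneg, ENNReal.ofReal_toReal (p.apply_ne_top a)]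

theorem entropy_map_equiv (e : α ≃ β) (p : PMF α) : entropy (p.map e) = entropy p := by
  rw [entropy, entropy, ← e.tsum_eq]
  simp only [map_equiv_apply, Equiv.symm_apply_apply]

theorem entropy_joint (p : PMF α) (κ : α → PMF β) :
    entropy (joint p κ) = entropy p + ∑' a, p a * entropy (κ a) := by
  rw [entropy_eq (joint p κ), ENNReal.tsum_prod', entropy_eq p, ← ENNReal.tsum_add]
  refine tsum_congr fun a => ?_
  rw [entropy_eq (κ a)]
  have : p a * ENNReal.ofReal (-Real.logb 2 (p a).toReal) =
      ∑' b, p a * κ a b * ENNReal.ofReal (-Real.logb 2 (p a).toReal) := by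
    rw [ENNReal.tsum_mul_right, ENNReal.tsum_mul_left, (κ a).tsum_coe, mul_one]
  rw [this, ← ENNReal.tsum_mul_left, ← ENNReal.tsum_add]
  refine tsum_congr fun b => ?_
  rw [joint_apply]
  dsimp only
  rcases eq_or_ne (p a) 0 with h | h
  · simp [h]
  rcases eq_or_ne (κ a b) 0 with h' | h'
  · simp [h']
  rw [ENNReal.toReal_mul, Real.logb_mul (ENNReal.toReal_pos h (p.apply_ne_top a)).ne'
    (ENNReal.toReal_pos h' ((κ a).apply_ne_top b)).ne', neg_add,
    ENNReal.ofReal_add (neg_logb_toReal_nonneg p a) (neg_logb_toReal_nonneg (κ a) b),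
    mul_add, mul_assoc, mul_assoc]

theorem tsum_bind_mul (p : PMF α) (κ : α → PMF β) (f : β → ℝ≥0∞) :
    ∑' b, p.bind κ b * f b = ∑' a, p a * ∑' b, κ a b * f b := by
  simp only [PMF.bind_apply, ← ENNReal.tsum_mul_right, ← ENNReal.tsum_mul_left]
  rw [ENNReal.tsum_comm]
  simp only [mul_assoc]

namespace MarkovSource

/-- The conditional entropy `H(s_m | s_0)`. -/
def stepEntropy (P : MarkovSource S) (m : ℕ) : ℝ≥0∞ := ∑' a, P.marg a * entropy (P.step m a)

/-- Chain rule: since `κ` preserves the marginal, every symbol of the path is stationary, and each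
one after the first adds `H(s_1 | s_0)`. -/
theorem tsum_marg_mul_entropy_pathFrom (P : MarkovSource S) (κ : S → PMF S)
    (hκ : P.marg.bind κ = P.marg) (l : ℕ) :
    ∑' a, P.marg a * entropy (P.pathFrom (κ a) l) =
      ∑' a, P.marg a * entropy (κ a) + l * P.stepEntropy 1 := by
  induction l generalizing κ with
  | zero =>
    simp only [Nat.cast_zero, zero_mul, add_zero]
    refine tsum_congr fun a => ?_
    congr 1
    exact entropy_map_equiv (Equiv.funUnique (Fin 1) S).symm (κ a)
  | succ l ih =>
    have h : ∀ a, entropy (P.pathFrom (κ a) (l + 1)) =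
        entropy (κ a) + ∑' b, κ a b * entropy (P.pathFrom (P.trans b) l) := by
      intro a
      rw [pathFrom, entropy_map_equiv, entropy_joint]
    simp only [h, mul_add, ENNReal.tsum_add]
    rw [← tsum_bind_mul, hκ, ih P.trans P.stationary]
    simp only [stepEntropy, step_one]
    push_cast
    ring

theorem condEntropy_windowLaw (P : MarkovSource S) (B W : ℕ) :
    condEntropy (P.windowLaw B W) = P.stepEntropy (B + 1) + W * P.stepEntropy 1 := by
  rw [windowLaw_eq_joint, condEntropy_joint,
    tsum_marg_mul_entropy_pathFrom _ _ (P.marg_bind_step _)]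
  rfl

end MarkovSource

/-- Jensen's inequality for `x ↦ -x log₂ x`. -/
theorem tsum_mul_negMulLog_le (p : PMF α) (q : α → ℝ≥0∞) (hq : ∀ a, q a ≤ 1) :
    ∑' a, p a * ENNReal.ofReal (-((q a).toReal * Real.logb 2 (q a).toReal)) ≤
      ENNReal.ofReal (-((∑' a, p a * q a).toReal * Real.logb 2 (∑' a, p a * q a).toReal)) := by
  set m := ∑' a, p a * q a with hm
  have hm1 : m ≤ 1 := by
    rw [← p.tsum_coe]
    exact ENNReal.tsum_le_tsum fun a => mul_le_of_le_one_right' (hq a)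
  rcases eq_or_ne m 0 with h0 | h0
  · refine (le_of_eq ?_).trans zero_le
    rw [ENNReal.tsum_eq_zero]
    intro a
    rcases mul_eq_zero.1 (ENNReal.tsum_eq_zero.1 (hm.symm.trans h0) a) with h | h <;> simp [h]
  have hmt : m ≠ ⊤ := ne_top_of_le_ne_top ENNReal.one_ne_top hm1
  have hmp : 0 < m.toReal := ENNReal.toReal_pos h0 hmt
  have hL : 0 ≤ -Real.logb 2 m.toReal :=
    neg_nonneg.2 (Real.logb_nonpos one_lt_two hmp.le
      (by simpa using ENNReal.toReal_mono ENNReal.one_ne_top hm1))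
  have hl2 : 0 < Real.log 2 := Real.log_pos one_lt_two
  have hc : 0 ≤ (Real.log 2)⁻¹ := (inv_pos.2 hl2).le
  set c := (Real.log 2)⁻¹ with hcdef
  -- The graph of `-x log₂ x` lies below its tangent at `m`. The term `c x`, with `c = 1 / log 2`,
  -- stands on the left to avoid truncated subtraction.
  have key : ∀ a, ENNReal.ofReal (-((q a).toReal * Real.logb 2 (q a).toReal)) +
      q a * ENNReal.ofReal c ≤ q a * ENNReal.ofReal (-Real.logb 2 m.toReal) +
        m * ENNReal.ofReal c := by
    intro a
    have hqt : q a ≠ ⊤ := ne_top_of_le_ne_top ENNReal.one_ne_top (hq a)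
    have hx0 : 0 ≤ (q a).toReal := ENNReal.toReal_nonneg
    have hx1 : (q a).toReal ≤ 1 := by simpa using ENNReal.toReal_mono ENNReal.one_ne_top (hq a)
    conv_lhs => rw [← ENNReal.ofReal_toReal hqt]
    conv_rhs => rw [← ENNReal.ofReal_toReal hqt, ← ENNReal.ofReal_toReal hmt]
    generalize (q a).toReal = x at *
    generalize m.toReal = y at *
    rw [ENNReal.toReal_ofReal hx0, ENNReal.toReal_ofReal hmp.le, ← ENNReal.ofReal_mul hx0,
      ← ENNReal.ofReal_mul hx0, ← ENNReal.ofReal_mul hmp.le,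
      ← ENNReal.ofReal_add (neg_nonneg.2 (mul_nonpos_of_nonneg_of_nonpos hx0
        (Real.logb_nonpos one_lt_two hx0 hx1))) (by positivity),
      ← ENNReal.ofReal_add (by positivity) (by positivity)]
    refine ENNReal.ofReal_le_ofReal ?_
    rcases hx0.eq_or_lt with rfl | hx
    · simp
      positivity
    have h1 := Real.log_le_sub_one_of_pos (div_pos hmp hx)
    rw [Real.log_div hmp.ne' hx.ne'] at h1
    have h2 : x * (Real.log y - Real.log x) ≤ y - x := by
      calc x * (Real.log y - Real.log x) ≤ x * (y / x - 1) := by gcongr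
        _ = y - x := by field_simp
    have h3 := mul_le_mul_of_nonneg_right h2 hc
    simp only [Real.logb, div_eq_mul_inv, ← hcdef]
    linarith
  have hfin : m * ENNReal.ofReal c ≠ ⊤ := ENNReal.mul_ne_top hmt ENNReal.ofReal_ne_top
  rw [← ENNReal.add_le_add_iff_right hfin]
  calc ∑' a, p a * ENNReal.ofReal (-((q a).toReal * Real.logb 2 (q a).toReal)) +
        m * ENNReal.ofReal c
      = ∑' a, p a * (ENNReal.ofReal (-((q a).toReal * Real.logb 2 (q a).toReal)) +
          q a * ENNReal.ofReal c) := by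
        simp only [mul_add, ENNReal.tsum_add, ← mul_assoc, ENNReal.tsum_mul_right, ← hm]
    _ ≤ ∑' a, p a * (q a * ENNReal.ofReal (-Real.logb 2 m.toReal) + m * ENNReal.ofReal c) := by
        exact ENNReal.tsum_le_tsum fun a => mul_le_mul_right (key a) _
    _ = _ := by
        simp only [mul_add, ENNReal.tsum_add, ← mul_assoc, ENNReal.tsum_mul_right, ← hm,
          p.tsum_coe, one_mul]
        rw [← mul_neg, ENNReal.ofReal_mul hmp.le, ENNReal.ofReal_toReal hmt]

/-- Conditioning reduces entropy: Jensen is applied to each value `b` separately. -/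
theorem tsum_mul_entropy_le (p : PMF α) (κ : α → PMF β) :
    ∑' a, p a * entropy (κ a) ≤ entropy (p.bind κ) := by
  simp only [entropy, ← ENNReal.tsum_mul_left]
  rw [ENNReal.tsum_comm]
  refine ENNReal.tsum_le_tsum fun b => ?_
  rw [PMF.bind_apply]
  exact tsum_mul_negMulLog_le p (fun a => κ a b) fun a => (κ a).coe_le_one b

namespace MarkovSource

/-- `H(s_m | s_0) = H(s_{m+1} | s_1) = H(s_{m+1} | s_0, s_1) ≤ H(s_{m+1} | s_0)`, by stationarity,
the Markov property and conditioning. -/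
theorem stepEntropy_le_succ (P : MarkovSource S) (m : ℕ) :
    P.stepEntropy m ≤ P.stepEntropy (m + 1) := by
  calc P.stepEntropy m = ∑' a, P.marg a * ∑' b, P.trans a b * entropy (P.step m b) := by
        rw [← tsum_bind_mul, P.stationary, stepEntropy]
    _ ≤ P.stepEntropy (m + 1) := by
        refine ENNReal.tsum_le_tsum fun a => ?_
        rw [step_succ]
        gcongr
        exact tsum_mul_entropy_le _ _

theorem stepEntropy_mono (P : MarkovSource S) : Monotone P.stepEntropy :=
  monotone_nat_of_le_succ P.stepEntropy_le_succ

theorem stepEntropy_le_entropy (P : MarkovSource S) (m : ℕ) :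
    P.stepEntropy m ≤ entropy P.marg := by
  rw [stepEntropy]
  refine (tsum_mul_entropy_le _ _).trans_eq ?_
  rw [marg_bind_step]

end MarkovSource

/-! ### Asymptotic equipartition -/

open MeasureTheory ProbabilityTheory in
/-- The weak law of large numbers. -/
theorem tendsto_iidLaw_deviation [Countable α] (q : PMF α) (f : α → ℝ) (hf : ∀ a, 0 ≤ f a)
    (h : ∑' a, q a * ENNReal.ofReal (f a) ≠ ⊤) {ε : ℝ} (hε : 0 < ε) :
    Tendsto (fun n : ℕ => (iidLaw q n).toOuterMeasure
      {z | ε ≤ |(∑ k, f (z k)) / n - (∑' a, q a * ENNReal.ofReal (f a)).toReal|}) atTop (𝓝 0) := by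
  let _ : MeasurableSpace α := ⊤
  have hmeas : ∀ g : α → ℝ, Measurable g := fun g _ _ => trivial
  have hl : ∫⁻ a, ENNReal.ofReal (f a) ∂q.toMeasure = ∑' a, q a * ENNReal.ofReal (f a) := by
    rw [lintegral_countable']
    refine tsum_congr fun a => ?_
    rw [PMF.toMeasure_apply_singleton _ _ (MeasurableSet.singleton _), mul_comm]
  have hint : Integrable f q.toMeasure := by
    refine ⟨(hmeas f).aestronglyMeasurable, ?_⟩
    rw [hasFiniteIntegral_iff_ofReal (ae_of_all _ hf), hl]
    exact h.lt_top
  have hI : ∫ a, f a ∂q.toMeasure = (∑' a, q a * ENNReal.ofReal (f a)).toReal := by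
    rw [integral_eq_lintegral_of_nonneg_ae (ae_of_all _ hf) (hmeas f).aestronglyMeasurable, hl]
  -- All block lengths live on one infinite product, where the strong law gives almost sure
  -- convergence, hence convergence in measure.
  set μ := Measure.infinitePi fun _ : ℕ => q.toMeasure with hμ
  set X : ℕ → (ℕ → α) → ℝ := fun i ω => f (ω i) with hX
  have hmap : ∀ i, μ.map (fun ω => ω i) = q.toMeasure := fun i => Measure.infinitePi_map_eval _ i
  have hXm : ∀ i, Measurable (X i) := fun i => (hmeas f).comp (measurable_pi_apply i)
  have hXI : Integrable (X 0) μ := by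
    have : Integrable f (μ.map fun ω => ω 0) := by rwa [hmap]
    exact this.comp_measurable (measurable_pi_apply 0)
  have hEX : μ[X 0] = (∑' a, q a * ENNReal.ofReal (f a)).toReal := by
    rw [← hI, ← hmap 0, integral_map (measurable_pi_apply 0).aemeasurable
      (hmeas f).aestronglyMeasurable]
  have hind : iIndepFun X μ := iIndepFun_infinitePi (X := fun _ : ℕ => f) fun _ => hmeas f
  have hid : ∀ i, IdentDistrib (X i) (X 0) μ μ := fun i =>
    { aemeasurable_fst := (hXm i).aemeasurable
      aemeasurable_snd := (hXm 0).aemeasurable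
      map_eq := by
        have : ∀ j, μ.map (X j) = q.toMeasure.map f := fun j => by
          rw [← hmap j, Measure.map_map (hmeas f) (measurable_pi_apply j)]
          rfl
        rw [this, this] }
  have hlaw := strong_law_ae_real X hXI (fun i j hij => hind.indepFun hij) hid
  rw [hEX] at hlaw
  have hmeasure := tendstoInMeasure_of_tendsto_ae (μ := μ)
    (f := fun (n : ℕ) ω => (∑ i ∈ Finset.range n, X i ω) / n)
    (g := fun _ => (∑' a, q a * ENNReal.ofReal (f a)).toReal)
    (fun n => ((Finset.measurable_fun_sum _ fun i _ => hXm i).div_const _).aestronglyMeasurable)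
    hlaw
  rw [tendstoInMeasure_iff_norm] at hmeasure
  refine (hmeasure ε hε).congr fun n => ?_
  have hr : μ.map (fun ω (k : Fin n) => ω k) = (iidLaw q n).toMeasure := by
    refine (Measure.map_infinitePi_infinitePi_of_inj (P := fun _ : ℕ => q.toMeasure)
      Fin.val_injective).trans (Measure.ext_of_singleton fun z => ?_)
    rw [Measure.infinitePi_singleton_of_fintype, PMF.toMeasure_apply_singleton _ _
      (MeasurableSet.singleton z), iidLaw_apply]
    exact Finset.prod_congr rfl fun k _ => PMF.toMeasure_apply_singleton _ _ (MeasurableSet.singleton _)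
  rw [← PMF.toMeasure_apply_eq_toOuterMeasure, ← hr, Measure.map_apply (by fun_prop)
    (Set.to_countable _).measurableSet]
  congr 1
  ext ω
  simp [Finset.sum_range, hX]

/-- The threshold `2^{-nc}`. -/
def threshold (n : ℕ) (c : ℝ) : ℝ≥0∞ := ENNReal.ofReal (2 ^ (-(n * c) : ℝ))

theorem prod_toReal_eq_rpow {n : ℕ} (x : Fin n → ℝ≥0∞) (h0 : ∀ k, x k ≠ 0) (ht : ∀ k, x k ≠ ⊤) :
    ∏ k, x k = ENNReal.ofReal (2 ^ (-∑ k, -Real.logb 2 (x k).toReal)) := by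
  have h1 : ∀ k, 0 < (x k).toReal := fun k => ENNReal.toReal_pos (h0 k) (ht k)
  rw [Finset.sum_neg_distrib, neg_neg, Real.rpow_sum_of_pos two_pos,
    ENNReal.ofReal_prod_of_nonneg fun k _ => by positivity]
  refine Finset.prod_congr rfl fun k _ => ?_
  rw [Real.rpow_logb two_pos (by norm_num) (h1 k), ENNReal.ofReal_toReal (ht k)]

theorem joint_mul_info (p : PMF α) (κ : α → PMF β) :
    ∑' z, joint p κ z * ENNReal.ofReal (-Real.logb 2 (κ z.1 z.2).toReal) =
      ∑' a, p a * entropy (κ a) := by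
  rw [ENNReal.tsum_prod']
  refine tsum_congr fun a => ?_
  rw [entropy_eq, ← ENNReal.tsum_mul_left]
  refine tsum_congr fun b => ?_
  rw [joint_apply, mul_assoc]

/-- Off the support a factor may vanish, and then the default `logb 2 0 = 0` breaks the passage from
products to sums of logarithms. -/
theorem joint_support_ne_zero (p : PMF α) (κ : α → PMF β) {n : ℕ} {z : Fin n → α × β}
    (hz : z ∈ (iidLaw (joint p κ) n).support) (k : Fin n) : κ (z k).1 (z k).2 ≠ 0 := by
  rw [PMF.mem_support_iff, iidLaw_apply, Finset.prod_ne_zero_iff] at hz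
  have := hz k (Finset.mem_univ k)
  rw [joint_apply] at this
  exact right_ne_zero_of_mul this

/-- Conditional probabilities are rarely much smaller than `2^{-nH}`. -/
theorem tendsto_prob_lt_threshold [Countable α] [Countable β] (p : PMF α) (κ : α → PMF β)
    (h : ∑' a, p a * entropy (κ a) ≠ ⊤) {c : ℝ} (hc : (∑' a, p a * entropy (κ a)).toReal < c) :
    Tendsto (fun n : ℕ => (iidLaw (joint p κ) n).toOuterMeasure
      {z | ∏ k, κ (z k).1 (z k).2 < threshold n c}) atTop (𝓝 0) := by
  have key := tendsto_iidLaw_deviation (joint p κ)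
    (fun z => -Real.logb 2 (κ z.1 z.2).toReal) (fun z => neg_logb_toReal_nonneg _ _)
    (by rwa [joint_mul_info]) (sub_pos.2 hc)
  rw [joint_mul_info] at key
  refine tendsto_of_tendsto_of_tendsto_of_le_of_le tendsto_const_nhds key (fun _ => zero_le)
    fun n => PMF.toOuterMeasure_mono _ ?_
  rintro z ⟨hz, hs⟩
  simp only [Set.mem_ofPred_eq] at hz ⊢
  rw [prod_toReal_eq_rpow _ (joint_support_ne_zero p κ hs) fun k => PMF.apply_ne_top _ _,
    threshold, ENNReal.ofReal_lt_ofReal_iff (by positivity),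
    Real.rpow_lt_rpow_left_iff one_lt_two, neg_lt_neg_iff] at hz
  refine le_trans ?_ (le_abs_self _)
  refine sub_le_sub_right ?_ _
  rcases Nat.eq_zero_or_pos n with rfl | hn
  · simp at hz
  · rw [le_div_iff₀ (by positivity), mul_comm]
    exact hz.le

/-- Conditional probabilities are rarely much larger than `2^{-nH}`. -/
theorem tendsto_prob_threshold_lt [Countable α] [Countable β] (p : PMF α) (κ : α → PMF β)
    (h : ∑' a, p a * entropy (κ a) ≠ ⊤) {c : ℝ} (hc : c < (∑' a, p a * entropy (κ a)).toReal) :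
    Tendsto (fun n : ℕ => (iidLaw (joint p κ) n).toOuterMeasure
      {z | threshold n c < ∏ k, κ (z k).1 (z k).2}) atTop (𝓝 0) := by
  have key := tendsto_iidLaw_deviation (joint p κ)
    (fun z => -Real.logb 2 (κ z.1 z.2).toReal) (fun z => neg_logb_toReal_nonneg _ _)
    (by rwa [joint_mul_info]) (sub_pos.2 hc)
  rw [joint_mul_info] at key
  refine tendsto_of_tendsto_of_tendsto_of_le_of_le tendsto_const_nhds key (fun _ => zero_le)
    fun n => PMF.toOuterMeasure_mono _ ?_
  rintro z ⟨hz, hs⟩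
  simp only [Set.mem_ofPred_eq] at hz ⊢
  rw [prod_toReal_eq_rpow _ (joint_support_ne_zero p κ hs) fun k => PMF.apply_ne_top _ _,
    threshold, ENNReal.ofReal_lt_ofReal_iff (by positivity),
    Real.rpow_lt_rpow_left_iff one_lt_two, neg_lt_neg_iff] at hz
  refine le_trans ?_ (neg_le_abs _)
  rw [neg_sub]
  refine sub_le_sub_left ?_ _
  rcases Nat.eq_zero_or_pos n with rfl | hn
  · simp at hz
  · rw [div_le_iff₀ (by positivity), mul_comm]
    exact hz.le

/-! ### The converse -/

/-- Some value is at most the weighted mean. The undivided form also covers total weight zero. -/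
theorem exists_mul_le_tsum_mul [Nonempty α] (w e : α → ℝ≥0∞) (hw : ∑' a, w a ≠ ⊤) :
    ∃ a, (∑' a, w a) * e a ≤ ∑' a, w a * e a := by
  by_contra! hlt
  set A := ∑' a, w a with hA
  set T := ∑' a, w a * e a with hT
  have hT_top : T ≠ ⊤ := (hlt (Classical.arbitrary α)).ne_top
  have hA0 : A ≠ 0 := by
    intro h
    have := hlt (Classical.arbitrary α)
    simp [h] at this
  have he : ∀ a, T / A < e a := fun a => ENNReal.div_lt_of_lt_mul' (hlt a)
  obtain ⟨a₀, ha₀⟩ : ∃ a, w a ≠ 0 := by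
    by_contra! h
    exact hA0 (ENNReal.tsum_eq_zero.2 h)
  have hsum : ∑' a, w a * (T / A) = T := by
    rw [ENNReal.tsum_mul_right, ENNReal.mul_div_cancel hA0 hw]
  have hwt : w a₀ ≠ ⊤ := ne_top_of_le_ne_top hw (ENNReal.le_tsum a₀)
  have := ENNReal.tsum_lt_tsum (hsum.trans_ne hT_top)
    (fun a => mul_le_mul_right (he a).le (w a)) ((ENNReal.mul_lt_mul_iff_right ha₀ hwt).2 (he a₀))
  rw [hsum] at this
  exact this.false

/-- If `Y` depends on `X` only through `π X`, then in an estimate of `Y` one may replace `X` by a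
function of `π X` without increasing the error probability. -/
theorem exists_section_prob_le (p : PMF α) (π : α → β) (κ : β → PMF γ) (err : α → γ → Prop) :
    ∃ σ : β → α, (joint (p.map π) κ).toOuterMeasure {z | err (σ z.1) z.2} ≤
      (joint p fun a => κ (π a)).toOuterMeasure {z | err z.1 z.2} := by
  classical
  have : Nonempty α := p.support_nonempty.to_subtype.map Subtype.val
  have hw : ∀ x, ∑' a, (if x = π a then p a else 0) = p.map π x := fun x =>
    (PMF.map_apply π p x).symm
  -- For each `x` the error is averaged over the fibre of `x`. The chosen `σ x` need not lie in that
  -- fibre.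
  choose σ hσ using fun x => exists_mul_le_tsum_mul (fun a => if x = π a then p a else 0)
    (fun a => (κ x).toOuterMeasure {y | err a y}) (by rw [hw]; exact PMF.apply_ne_top _ _)
  refine ⟨σ, ?_⟩
  rw [joint_toOuterMeasure, joint_toOuterMeasure]
  calc _ ≤ ∑' x, ∑' a, (if x = π a then p a else 0) * (κ x).toOuterMeasure {y | err a y} := by
        refine ENNReal.tsum_le_tsum fun x => ?_
        rw [← hw]
        exact hσ x
    _ = _ := by
        rw [ENNReal.tsum_comm]
        refine tsum_congr fun a => ?_
        rw [tsum_eq_single (π a)]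
        · simp
        · intro x hx
          simp [hx]

/-- `G` has at most `Fintype.card T` points. For the converse, `T` is the set of message tuples and
`G` the set of windows decoded correctly. -/
theorem toOuterMeasure_le_card_mul (κ : PMF α) (G : Set α) {T : Type*} [Fintype T] (φ : α → T)
    (hφ : Set.InjOn φ G) (θ : ℝ≥0∞) :
    κ.toOuterMeasure {y | y ∈ G ∧ κ y ≤ θ} ≤ Fintype.card T * θ := by
  calc κ.toOuterMeasure {y | y ∈ G ∧ κ y ≤ θ}
      ≤ ∑' y, G.indicator (fun _ => θ) y := by
        rw [PMF.toOuterMeasure_apply]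
        refine ENNReal.tsum_le_tsum fun y => ?_
        by_cases h : y ∈ G ∧ κ y ≤ θ
        · rw [Set.indicator_of_mem (by exact h), Set.indicator_of_mem h.1]
          exact h.2
        · rw [Set.indicator_of_notMem (by exact h)]
          exact zero_le
    _ = ∑' y : G, θ := (tsum_subtype G fun _ => θ).symm
    _ ≤ ∑' _ : T, θ := ENNReal.tsum_comp_le_tsum_of_injective
        (f := fun y : G => φ y) (fun y y' h => Subtype.ext (hφ y.2 y'.2 h)) fun _ => θ
    _ = Fintype.card T * θ := by simp

theorem iidLaw_map_apply (q : PMF α) (n : ℕ) (g : α → β) (s : Set (Fin n → β)) :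
    (iidLaw (q.map g) n).toOuterMeasure s =
      (iidLaw q n).toOuterMeasure {z | (fun k => g (z k)) ∈ s} := by
  rw [← iidLaw_map, PMF.toOuterMeasure_map_apply]
  rfl

theorem iidLaw_joint_apply (p : PMF α) (κ : α → PMF β) (n : ℕ)
    (s : Set ((Fin n → α) × (Fin n → β))) :
    (joint (iidLaw p n) fun x => prodLaw fun k => κ (x k)).toOuterMeasure s =
      (iidLaw (joint p κ) n).toOuterMeasure {z | (fun k => (z k).1, fun k => (z k).2) ∈ s} := by
  rw [← iidLaw_joint, PMF.toOuterMeasure_map_apply]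
  rfl

namespace Code

variable {n L M : ℕ}

theorem channelInput_eq {c : Code S n L M} {F : Fin (L + 1) → (Fin n → S) → Fin M}
    (hF : ∀ i past, c.enc i past = F i (past (Fin.last (i + 1))))
    (ω : Fin n → Fin (L + 2) → S) (i : Fin (L + 1)) :
    c.channelInput ω i = F i (block ω i.succ) := by
  rw [channelInput, hF]
  rfl

end Code

theorem MarkovSource.pathLaw_map_last (P : MarkovSource S) (t : ℕ) :
    (P.pathLaw t).map (fun x => x (Fin.last t)) = P.marg := by
  have h := congrArg (PMF.map fun y : Fin 1 → S => y 0) (P.pathLaw_map_window t 0 t le_rfl)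
  rw [PMF.map_comp, pathLaw_eq P 0, pathFrom, PMF.map_comp] at h
  exact h.trans (P.marg.map_id)

/-- For a memoryless code without erasures, `s_i^n` can be estimated from `s_{i-1}^n` and `f_i`. -/
theorem exists_forward_estimate (P : MarkovSource S) {n L M : ℕ} (c : Code S n L M)
    {F : Fin (L + 1) → (Fin n → S) → Fin M}
    (hF : ∀ i past, c.enc i past = F i (past (Fin.last (i + 1)))) (i : Fin (L + 1)) :
    ∃ E : (Fin n → S) → Fin M → (Fin n → S),
      (iidLaw (joint P.marg P.trans) n).toOuterMeasure
        {z | E (fun k => (z k).1) (F i fun k => (z k).2) ≠ fun k => (z k).2} ≤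
      c.errorProb P (L + 1) 0 i := by
  -- Encoders being memoryless, the earlier channel inputs are recomputed from the past. Position `t
  -- + 1` of a path holds `s_t`.
  let guess (past : Fin n → Fin ((i : ℕ) + 1) → S) (m : Fin M) : Fin n → S :=
    c.dec i (fun t => some (if h : (t : ℕ) < i then
      F ⟨t, by omega⟩ (fun k => past k ⟨t + 1, by omega⟩) else m)) (fun k => past k 0)
  -- Given the past, `s_i` depends on `s_{i-1}` alone, so the past may be replaced by a function of
  -- `s_{i-1}`.
  obtain ⟨σ, hσ⟩ := exists_section_prob_le (iidLaw (P.pathLaw i) n)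
    (fun past k => past k (Fin.last i)) (fun x => prodLaw fun k => P.trans (x k))
    (fun past y => guess past (F i y) ≠ y)
  refine ⟨fun x m => guess (σ x) m, ?_⟩
  have hlast : (iidLaw (P.pathLaw i) n).map (fun past k => past k (Fin.last i)) =
      iidLaw P.marg n := by
    rw [← P.pathLaw_map_last i]
    exact iidLaw_map (P.pathLaw i) n fun x => x (Fin.last i)
  rw [hlast, iidLaw_joint_apply] at hσ
  refine hσ.trans (le_of_eq ?_)
  have h1 := iidLaw_joint_apply (P.pathLaw i) (fun x => P.trans (x (Fin.last i))) n
    {z | guess z.1 (F i z.2) ≠ z.2}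
  refine h1.trans ?_
  rw [← P.pathLaw_map_past i (L + 1) (by omega), iidLaw_map_apply]
  rw [Code.errorProb, MarkovSource.blockLaw]
  congr 1
  ext ω
  simp only [Set.mem_ofPred_eq, Code.reconstruction]
  have hdec : guess (fun k u => ω k ⟨u, by omega⟩) (F i fun k => ω k ⟨i + 1, by omega⟩) =
      c.dec i (fun t => c.channelOutput (L + 1) 0 ω ⟨t, by omega⟩) (block ω 0) := by
    simp only [guess]
    congr 1
    funext t
    rw [Code.channelOutput, if_neg (by simp), Code.channelInput_eq hF]
    congr 1
    split_ifs with h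
    · rfl
    · have ht : (t : ℕ) = i := by omega
      simp only [ht]
      rfl
  rw [hdec]
  rfl

/-- The single-letter bound behind the converse, for a fixed block length. -/
theorem one_le_of_errorProb_le (P : MarkovSource S) (hsym : P.IsSymmetric) {n L M B W : ℕ}
    (hL : B + W ≤ L) (c : Code S n L M) (hc : c.IsMemoryless) (ε θ : ℝ≥0∞)
    (hε : ∀ j b : ℕ, b ≤ B → ∀ i : Fin (L + 1), ¬ (j ≤ (i : ℕ) ∧ (i : ℕ) < j + b + W) →
      c.errorProb P j b i ≤ ε) :
    1 ≤ (W + 1) * ε + M ^ (W + 1) * θ +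
      (iidLaw (joint P.marg fun a => P.pathFrom (P.step (B + 1) a) W) n).toOuterMeasure
        {z | θ < ∏ k, P.pathFrom (P.step (B + 1) (z k).1) W (z k).2} := by
  choose F hF using hc
  choose E hE using exists_forward_estimate P c hF
  -- Time `B + W` is the first at which recovery is required after the burst `{0, …, B-1}`.
  let D (x : Fin n → S) (m : Fin (W + 1) → Fin M) : Fin n → S :=
    c.dec ⟨B + W, by omega⟩ (fun t => if (t : ℕ) < B then none else
      some (m ⟨t - B, by have := t.2; simp only at this; omega⟩)) x
  let msg (y : Fin n → Fin (W + 1) → S) (u : Fin (W + 1)) : Fin M :=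
    F ⟨B + u, by omega⟩ fun k => y k u
  let good (x : Fin n → S) (y : Fin n → Fin (W + 1) → S) : Prop :=
    D x (msg y) = (fun k => y k (Fin.last W)) ∧
      ∀ u : Fin W, E ⟨B + u, by omega⟩ (fun k => y k u.succ) (msg y u.castSucc) =
        fun k => y k u.castSucc
  -- `D` fixes the last symbol of the window; then `E` recovers each symbol from its successor.
  have hinj : ∀ x, Set.InjOn msg {y | good x y} := by
    intro x y hy y' hy' hm
    have key : ∀ u : Fin (W + 1), (fun k => y k u) = fun k => y' k u := by
      intro u
      induction u using Fin.reverseInduction with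
      | last => rw [← hy.1, ← hy'.1, hm]
      | cast u ih => rw [← hy.2, ← hy'.2, hm, ih]
    funext k u
    exact congrFun (key u) k
  let κ : S → PMF (Fin (W + 1) → S) := fun a => P.pathFrom (P.step (B + 1) a) W
  set q := iidLaw (joint P.marg κ) n with hq
  let X (z : Fin n → S × (Fin (W + 1) → S)) : Fin n → S := fun k => (z k).1
  let Y (z : Fin n → S × (Fin (W + 1) → S)) : Fin n → Fin (W + 1) → S := fun k => (z k).2
  have hwin : (P.pathLaw (L + 1)).map (fun x => (x ⟨0, by omega⟩,
      fun u : Fin (W + 1) => x ⟨0 + B + 1 + u, by omega⟩)) = joint P.marg κ :=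
    (P.pathLaw_map_window_pair 0 B W (L + 1) (by omega)).trans (P.windowLaw_eq_joint B W)
  have hD : q.toOuterMeasure {z | D (X z) (msg (Y z)) ≠ fun k => Y z k (Fin.last W)} ≤ ε := by
    refine le_trans (le_of_eq ?_) (hε 0 B le_rfl ⟨B + W, by omega⟩ (by simp))
    rw [hq, ← hwin, iidLaw_map_apply, Code.errorProb, MarkovSource.blockLaw]
    congr 1
    ext ω
    simp only [Set.mem_ofPred_eq, Code.reconstruction, D]
    have hout : (fun t : Fin (B + W + 1) => if (t : ℕ) < B then none else
        some (msg (fun k (u : Fin (W + 1)) => ω k ⟨0 + B + 1 + u, by omega⟩)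
          ⟨t - B, by omega⟩)) =
        fun t : Fin (B + W + 1) => c.channelOutput 0 B ω ⟨t, by omega⟩ := by
      funext t
      rw [Code.channelOutput, Code.channelInput_eq hF]
      by_cases h : (t : ℕ) < B
      · simp [h]
      · simp only [h, if_false, zero_add, and_false, msg]
        congr 2
        · congr 1
          omega
        · funext k
          simp only [block]
          congr 1
          ext
          simp
          omega
    have hlast : (fun k => ω k ⟨0 + B + 1 + (Fin.last W : ℕ), by simp; omega⟩) =
        block ω (Fin.succ ⟨B + W, by omega⟩) := by
      funext k
      simp only [block]
      congr 1
      ext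
      simp
      omega
    rw [← hlast]
    refine not_congr (Eq.congr ?_ rfl)
    exact congrArg (fun g : Fin (B + W + 1) → Option (Fin M) =>
      c.dec ⟨B + W, by omega⟩ g (block ω 0)) hout
  have hEu : ∀ u : Fin W, q.toOuterMeasure
      {z | E ⟨B + u, by omega⟩ (fun k => Y z k u.succ) (msg (Y z) u.castSucc) ≠
        fun k => Y z k u.castSucc} ≤ ε := by
    intro u
    -- An empty burst that starts at `L + 1` exempts no time up to `L`; one that starts at `0` would
    -- exempt the first `W` times.
    refine le_trans (le_of_eq ?_) ((hE ⟨B + u, by omega⟩).trans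
      (hε (L + 1) 0 (Nat.zero_le _) ⟨B + u, by omega⟩ (by simp; omega)))
    -- Reversibility: `(s_{i+1}, s_i)` has the law of `(s_{i-1}, s_i)`, so the forward estimator
    -- works backwards.
    have hpair : (P.pathLaw (L + 1)).map (fun x => (x ⟨B + u + 1 + 1, by omega⟩,
        x ⟨B + u + 1, by omega⟩)) = joint P.marg P.trans := by
      rw [← hsym.swap, ← funext P.step_one,
        ← P.pathLaw_map_pair (B + u + 1) 1 (L + 1) le_rfl (by omega), PMF.map_comp]
      rfl
    rw [hq, ← hwin, ← hpair, iidLaw_map_apply, iidLaw_map_apply]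
    congr 1
    ext ω
    have h1 : ∀ k, ω k ⟨0 + B + 1 + (u.succ : ℕ), by simp; omega⟩ =
        ω k ⟨B + u + 1 + 1, by omega⟩ := by
      intro k; congr 1; ext; simp; omega
    have h2 : ∀ k, ω k ⟨0 + B + 1 + (u.castSucc : ℕ), by simp; omega⟩ =
        ω k ⟨B + u + 1, by omega⟩ := by
      intro k; congr 1; ext; simp; omega
    simp only [Set.mem_ofPred_eq, Y, msg, h1, h2]
    rfl
  have hbad : q.toOuterMeasure {z | ¬ good (X z) (Y z)} ≤ (W + 1) * ε := by
    have hsub : {z | ¬ good (X z) (Y z)} ⊆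
        {z | D (X z) (msg (Y z)) ≠ fun k => Y z k (Fin.last W)} ∪
        ⋃ u : Fin W, {z | E ⟨B + u, by omega⟩ (fun k => Y z k u.succ) (msg (Y z) u.castSucc) ≠
          fun k => Y z k u.castSucc} := by
      intro z hz
      by_contra h
      rw [Set.mem_union, Set.mem_iUnion, not_or, not_exists] at h
      exact hz ⟨not_not.1 h.1, fun u => not_not.1 (h.2 u)⟩
    refine (MeasureTheory.measure_mono hsub).trans ((MeasureTheory.measure_union_le _ _).trans ?_)
    rw [add_comm, add_mul, one_mul]
    refine add_le_add ?_ hD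
    refine (MeasureTheory.measure_iUnion_fintype_le _ _).trans ?_
    refine (Finset.sum_le_sum fun u _ => hEu u).trans ?_
    simp
  have hsmall : q.toOuterMeasure {z | good (X z) (Y z) ∧
      ∏ k, κ (z k).1 (z k).2 ≤ θ} ≤ M ^ (W + 1) * θ := by
    have h1 := iidLaw_joint_apply P.marg κ n
      {z | good z.1 z.2 ∧ prodLaw (fun k => κ (z.1 k)) z.2 ≤ θ}
    refine h1.symm.le.trans ?_
    rw [joint_toOuterMeasure]
    calc _ ≤ ∑' x, iidLaw P.marg n x * (M ^ (W + 1) * θ) := by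
          refine ENNReal.tsum_le_tsum fun x => mul_le_mul_right ?_ _
          have := toOuterMeasure_le_card_mul (prodLaw fun k => κ (x k)) {y | good x y} msg
            (hinj x) θ
          simpa using this
      _ = _ := by rw [ENNReal.tsum_mul_right, PMF.tsum_coe, one_mul]
  calc (1 : ℝ≥0∞) = q.toOuterMeasure Set.univ :=
        ((PMF.toOuterMeasure_apply_eq_one_iff _ _).2 (Set.subset_univ _)).symm
    _ ≤ q.toOuterMeasure (({z | ¬ good (X z) (Y z)} ∪ {z | good (X z) (Y z) ∧
          ∏ k, κ (z k).1 (z k).2 ≤ θ}) ∪ {z | θ < ∏ k, κ (z k).1 (z k).2}) := by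
        refine MeasureTheory.measure_mono fun z _ => ?_
        by_cases h1 : good (X z) (Y z)
        · rcases le_or_gt (∏ k, κ (z k).1 (z k).2) θ with h2 | h2
          · exact Or.inl (Or.inr ⟨h1, h2⟩)
          · exact Or.inr h2
        · exact Or.inl (Or.inl h1)
    _ ≤ _ := (MeasureTheory.measure_union_le _ _).trans
        (add_le_add_left ((MeasureTheory.measure_union_le _ _).trans
          (add_le_add hbad hsmall)) _)

theorem numMessages_le (n : ℕ) (R : ℝ≥0) :
    (numMessages n R : ℝ≥0∞) ≤ ENNReal.ofReal (2 ^ ((n : ℝ) * R)) := by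
  rw [← ENNReal.ofReal_natCast]
  exact ENNReal.ofReal_le_ofReal (Nat.floor_le (by positivity))

theorem tendsto_ofReal_two_rpow_neg {δ : ℝ} (hδ : 0 < δ) :
    Tendsto (fun n : ℕ => ENNReal.ofReal (2 ^ (-(n * δ) : ℝ))) atTop (𝓝 0) := by
  rw [← ENNReal.ofReal_zero]
  refine ENNReal.tendsto_ofReal ?_
  have h : ∀ n : ℕ, (2 : ℝ) ^ (-(n * δ) : ℝ) = ((2 : ℝ) ^ (-δ)) ^ n := by
    intro n
    rw [← Real.rpow_mul_natCast two_pos.le]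
    congr 1
    ring
  simp only [h]
  exact tendsto_pow_atTop_nhds_zero_of_lt_one (by positivity)
    (Real.rpow_lt_one_of_one_lt_of_neg one_lt_two (neg_neg_of_pos hδ))

theorem numMessages_pow_mul_threshold_le (n k : ℕ) (R : ℝ≥0) (c : ℝ) :
    (numMessages n R : ℝ≥0∞) ^ k * threshold n c ≤
      ENNReal.ofReal (2 ^ (-(n * (c - k * R)) : ℝ)) := by
  calc _ ≤ ENNReal.ofReal (2 ^ ((n : ℝ) * R)) ^ k * threshold n c := by
        gcongr
        exact numMessages_le n R
    _ = _ := by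
        rw [threshold, ← ENNReal.ofReal_pow (by positivity), ← ENNReal.ofReal_mul (by positivity),
          ← Real.rpow_mul_natCast two_pos.le, ← Real.rpow_add two_pos]
        congr 2
        ring

/-- If the rate were too small, a `c` strictly between `(W + 1) R` and the entropy would send all
three terms of `one_le_of_errorProb_le` to zero. -/
theorem condEntropy_le_of_feasible [Countable S] (P : MarkovSource S)
    (hfin : entropy P.marg ≠ ⊤) (hsym : P.IsSymmetric) {L B W : ℕ} (hL : B + W ≤ L) {R : ℝ≥0}
    (hR : MemorylessFeasible P L B W R) :
    condEntropy (P.windowLaw B W) ≤ (W + 1) * R := by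
  obtain ⟨code, ε, hmem, hε, herr⟩ := hR
  by_contra! hlt
  have hH : condEntropy (P.windowLaw B W) ≠ ⊤ := by
    rw [P.condEntropy_windowLaw]
    exact ENNReal.add_ne_top.2 ⟨ne_top_of_le_ne_top hfin (P.stepEntropy_le_entropy _),
      ENNReal.mul_ne_top (ENNReal.natCast_ne_top _)
        (ne_top_of_le_ne_top hfin (P.stepEntropy_le_entropy _))⟩
  have hlt' : ((W : ℝ) + 1) * R < (condEntropy (P.windowLaw B W)).toReal := by
    have := (ENNReal.toReal_lt_toReal (ne_top_of_lt hlt) hH).2 hlt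
    simpa [ENNReal.toReal_add] using this
  obtain ⟨c, hc1, hc2⟩ := exists_between hlt'
  rw [P.windowLaw_eq_joint, condEntropy_joint] at hH hc2
  have h1 := tendsto_prob_threshold_lt P.marg _ hH hc2
  have h2 : Tendsto (fun n : ℕ => (numMessages n R : ℝ≥0∞) ^ (W + 1) * threshold n c)
      atTop (𝓝 0) := by
    refine tendsto_of_tendsto_of_tendsto_of_le_of_le tendsto_const_nhds
      (tendsto_ofReal_two_rpow_neg (δ := c - (W + 1 : ℕ) * R) ?_) (fun _ => zero_le)
      fun n => numMessages_pow_mul_threshold_le n (W + 1) R c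
    push_cast
    linarith
  have h3 : Tendsto (fun n => ((W : ℝ≥0∞) + 1) * ε n) atTop (𝓝 0) := by
    have := ENNReal.Tendsto.const_mul (a := (W : ℝ≥0∞) + 1) hε
      (Or.inr (ENNReal.add_ne_top.2 ⟨ENNReal.natCast_ne_top W, ENNReal.one_ne_top⟩))
    simpa using this
  have hlim := (h3.add h2).add h1
  rw [add_zero, add_zero] at hlim
  have := ge_of_tendsto' hlim fun n => one_le_of_errorProb_le P hsym hL (code n) (hmem n) (ε n)
    (threshold n c) (herr n)
  simp at this

/-! ### Achievability by random binning -/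

section Decoding

variable {X : Type*} {M : ℕ}

/-- Two sequences of symbols are compatible with the same channel outputs only if they agree at
time `i`, provided that neither the chain `K₁` of adjacent symbols nor the windows after a burst
(whose first symbol is related by `K₂ b` to the last symbol before a burst of length `b`) can be
confused by the binning `F`. -/
theorem eq_of_compatible {L B W : ℕ} {F : ℕ → X → Fin M} {K₁ : X → X → Prop}
    {K₂ : ℕ → X → X → Prop} {s z : ℕ → X}
    (hstep : ∀ t < L + 1, ∀ y, y ≠ s (t + 1) → K₁ (s t) y → F t y ≠ F t (s (t + 1)))
    (hwin : ∀ j b, b ≤ B → j + b + W ≤ L → ∀ y : Fin (W + 1) → X, K₂ b (s j) (y 0) →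
      (∀ u : Fin W, K₁ (y u.castSucc) (y u.succ)) → (∀ u, y u ≠ s (j + b + 1 + u)) →
      ∃ u : Fin (W + 1), F (j + b + u) (y u) ≠ F (j + b + u) (s (j + b + 1 + u)))
    {i j b : ℕ} (hi : i < L + 1) (hb : b ≤ B) (hij : ¬ (j ≤ i ∧ i < j + b + W))
    (h0 : z 0 = s 0) (hz₁ : ∀ t ≤ i, K₁ (z t) (z (t + 1)))
    (hz₂ : ∀ t b, b ≤ B → t + b ≤ i → K₂ b (z t) (z (t + b + 1)))
    (hF : ∀ t ≤ i, ¬ (j ≤ t ∧ t < j + b) → F t (z (t + 1)) = F t (s (t + 1))) :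
    z (i + 1) = s (i + 1) := by
  -- Agreement propagates through times that are not erased. The index `t + 1` of `z` and `s`
  -- belongs to channel time `t`.
  have forward : ∀ t d, t + d ≤ i + 1 → z t = s t →
      (∀ t', t ≤ t' → t' < t + d → ¬ (j ≤ t' ∧ t' < j + b)) → z (t + d) = s (t + d) := by
    intro t d
    induction d with
    | zero => intro _ h _; exact h
    | succ d ih =>
      intro hd ht hno
      have hprev := ih (by omega) ht fun t' h1 h2 => hno t' h1 (by omega)
      by_contra hne
      refine hstep (t + d) (by omega) (z (t + d + 1)) hne ?_
        (hF (t + d) (by omega) (hno _ (by omega) (by omega)))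
      rw [← hprev]
      exact hz₁ _ (by omega)
  rcases lt_or_ge i j with hlt | hge
  · have := forward 0 (i + 1) (by omega) h0 fun t' _ h2 => by omega
    rwa [zero_add] at this
  · have hiW : j + b + W ≤ i := by omega
    have hj : z j = s j := by
      have := forward 0 j (by omega) h0 fun t' _ h2 => by omega
      rwa [zero_add] at this
    -- One agreement inside the window is enough, as `forward` carries it to time `i`.
    obtain ⟨u, hu⟩ : ∃ u : Fin (W + 1), z (j + b + 1 + u) = s (j + b + 1 + u) := by
      by_contra! hne
      obtain ⟨u, hu⟩ := hwin j b hb (by omega) (fun u => z (j + b + 1 + u))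
        (by rw [← hj]; exact hz₂ j b hb (by omega))
        (fun u => by
          have := hz₁ (j + b + 1 + u) (by omega)
          simpa [add_assoc] using this) hne
      refine hu ?_
      have := hF (j + b + u) (by omega) (by omega)
      rwa [show j + b + u + 1 = j + b + 1 + u by omega] at this
    have := forward (j + b + 1 + u) (i - (j + b + u)) (by omega) hu fun t' h1 h2 => by omega
    rwa [show j + b + 1 + u + (i - (j + b + u)) = i + 1 by omega] at this

end Decoding

/-! ### Collision probabilities of random binnings -/

section RandomBinning

open MeasureTheory

variable {X : Type*} {M : ℕ} [NeZero M]

/-- The law of a family of independent uniform binnings of `X` into `M` bins, one for each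
time. -/
def binningMeasure (X : Type*) (M : ℕ) [NeZero M] : Measure (ℕ → X → Fin M) :=
  Measure.infinitePi fun _ => Measure.infinitePi fun _ =>
    (PMF.uniformOfFintype (Fin M)).toMeasure

instance : IsProbabilityMeasure (binningMeasure X M) := by
  unfold binningMeasure
  infer_instance

/-- Each of the `M` possible common values has probability `M⁻²`. -/
theorem infinitePi_uniform_collision_le {y y' : X} (h : y ≠ y') :
    (Measure.infinitePi fun _ : X => (PMF.uniformOfFintype (Fin M)).toMeasure)
      {f | f y = f y'} ≤ (M : ℝ≥0∞)⁻¹ := by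
  classical
  have hsub : {f : X → Fin M | f y = f y'} ⊆
      ⋃ m : Fin M, Set.pi (({y, y'} : Finset X) : Set X) fun _ => {m} := by
    intro f hf
    simp only [Set.mem_iUnion, Set.mem_pi]
    refine ⟨f y, fun x hx => ?_⟩
    simp only [Finset.coe_insert, Finset.coe_singleton, Set.mem_insert_iff,
      Set.mem_singleton_iff] at hx
    rcases hx with rfl | rfl
    · rfl
    · exact hf.symm
  refine (measure_mono hsub).trans ((measure_iUnion_fintype_le _ _).trans ?_)
  have hM : (M : ℝ≥0∞) ≠ 0 := by simp [NeZero.ne M]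
  have h1 : ∀ m : Fin M, (Measure.infinitePi fun _ : X =>
      (PMF.uniformOfFintype (Fin M)).toMeasure)
      (Set.pi (({y, y'} : Finset X) : Set X) fun _ => {m}) = (M : ℝ≥0∞)⁻¹ * (M : ℝ≥0∞)⁻¹ := by
    intro m
    rw [Measure.infinitePi_pi _ fun _ _ => MeasurableSet.singleton m, Finset.prod_pair h,
      PMF.toMeasure_apply_singleton _ _ (MeasurableSet.singleton m)]
    simp
  simp only [h1]
  rw [Finset.sum_const, Finset.card_univ, Fintype.card_fin, nsmul_eq_mul, ← mul_assoc,
    ENNReal.mul_inv_cancel hM (ENNReal.natCast_ne_top M), one_mul]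

theorem binningMeasure_collision_le {ι : Type*} [Fintype ι] {τ : ι → ℕ}
    (hτ : Function.Injective τ) {y y' : ι → X} (h : ∀ u, y u ≠ y' u) :
    binningMeasure X M {F | ∀ u, F (τ u) (y u) = F (τ u) (y' u)} ≤
      (M : ℝ≥0∞)⁻¹ ^ Fintype.card ι := by
  have hmeas : ∀ u, MeasurableSet {f : X → Fin M | f (y u) = f (y' u)} := fun u =>
    measurableSet_eq_fun (measurable_pi_apply _) (measurable_pi_apply _)
  have hset : {F : ℕ → X → Fin M | ∀ u, F (τ u) (y u) = F (τ u) (y' u)} =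
      (fun F u => F (τ u)) ⁻¹' Set.pi ((Finset.univ : Finset ι) : Set ι)
        fun u => {f : X → Fin M | f (y u) = f (y' u)} := by
    ext F
    simp
  rw [hset, ← Measure.map_apply (by fun_prop)
    (MeasurableSet.pi (Finset.countable_toSet _) fun u _ => hmeas u), binningMeasure,
    Measure.map_infinitePi_infinitePi_of_inj hτ, Measure.infinitePi_pi _ fun u _ => hmeas u]
  refine (Finset.prod_le_prod' fun u _ => infinitePi_uniform_collision_le (h u)).trans ?_
  simp

/-- Union bound over `A`, which has at most `θ⁻¹` points because each carries mass at least `θ`. -/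
theorem measure_exists_le_of_weight {Φ Z : Type*} [MeasurableSpace Φ] [Countable Z]
    (μ : Measure Φ) (κ : PMF Z) (A : Set Z) (C : Z → Set Φ) {θ δ : ℝ≥0∞} (hθ0 : θ ≠ 0)
    (hθt : θ ≠ ⊤) (hA : ∀ z ∈ A, θ ≤ κ z) (hC : ∀ z ∈ A, μ (C z) ≤ δ) :
    μ {φ | ∃ z ∈ A, φ ∈ C z} ≤ θ⁻¹ * δ := by
  have hsub : {φ | ∃ z ∈ A, φ ∈ C z} ⊆ ⋃ z, {φ | z ∈ A ∧ φ ∈ C z} := by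
    rintro φ ⟨z, hz, hφ⟩
    exact Set.mem_iUnion.2 ⟨z, hz, hφ⟩
  calc μ {φ | ∃ z ∈ A, φ ∈ C z} ≤ ∑' z, μ {φ | z ∈ A ∧ φ ∈ C z} :=
        (measure_mono hsub).trans (measure_iUnion_le _)
    _ ≤ ∑' z, κ z * (θ⁻¹ * δ) := by
        refine ENNReal.tsum_le_tsum fun z => ?_
        by_cases hz : z ∈ A
        · simp only [hz, true_and]
          calc μ (C z) ≤ θ * θ⁻¹ * δ := by
                rw [ENNReal.mul_inv_cancel hθ0 hθt, one_mul]
                exact hC z hz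
            _ ≤ κ z * (θ⁻¹ * δ) := by
                rw [mul_assoc]
                exact mul_le_mul_left (hA z hz) _
        · simp [hz]
    _ = θ⁻¹ * δ := by rw [ENNReal.tsum_mul_right, κ.tsum_coe, one_mul]

/-- Derandomization: some `φ` does no worse than the average. Measurable hulls spare any
measurability assumption on `bad`. -/
theorem exists_prob_mem_le {Φ Ω : Type*} [MeasurableSpace Φ] [Countable Ω] (μ : Measure Φ)
    [IsProbabilityMeasure μ] (p : PMF Ω) (bad : Ω → Set Φ) {c : ℝ≥0∞}
    (hc : ∀ ω, μ (bad ω) ≤ c) : ∃ φ, p.toOuterMeasure {ω | φ ∈ bad ω} ≤ c := by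
  have hm : ∀ ω, Measurable ((toMeasurable μ (bad ω)).indicator fun _ => p ω) := fun ω =>
    measurable_const.indicator (measurableSet_toMeasurable _ _)
  obtain ⟨φ, hφ⟩ := exists_le_lintegral (μ := μ)
    (f := fun φ => ∑' ω, (toMeasurable μ (bad ω)).indicator (fun _ => p ω) φ)
    (Measurable.tsum hm).aemeasurable
  refine ⟨φ, ?_⟩
  calc p.toOuterMeasure {ω | φ ∈ bad ω}
      ≤ ∑' ω, (toMeasurable μ (bad ω)).indicator (fun _ => p ω) φ := by
        rw [PMF.toOuterMeasure_apply]
        refine ENNReal.tsum_le_tsum fun ω => ?_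
        by_cases h : φ ∈ bad ω
        · rw [Set.indicator_of_mem (by exact h),
            Set.indicator_of_mem (subset_toMeasurable μ _ h)]
        · rw [Set.indicator_of_notMem (by exact h)]
          exact zero_le
    _ ≤ ∫⁻ φ, ∑' ω, (toMeasurable μ (bad ω)).indicator (fun _ => p ω) φ ∂μ := hφ
    _ = ∑' ω, p ω * μ (bad ω) := by
        rw [lintegral_tsum fun ω => (hm ω).aemeasurable]
        refine tsum_congr fun ω => ?_
        rw [lintegral_indicator_const (measurableSet_toMeasurable _ _), measure_toMeasurable]
    _ ≤ ∑' ω, p ω * c := ENNReal.tsum_le_tsum fun ω => mul_le_mul_right (hc ω) _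
    _ = c := by rw [ENNReal.tsum_mul_right, p.tsum_coe, one_mul]

end RandomBinning

/-! ### The binning code and its error events -/

namespace MarkovSource

/-- The `m`-step transition probability of `n` independent copies of the chain. -/
def blockStep (P : MarkovSource S) (m : ℕ) {n : ℕ} (x y : Fin n → S) : ℝ≥0∞ :=
  ∏ k, P.step m (x k) (y k)

end MarkovSource

section

variable {n L M : ℕ}

/-- The binning `F` can confuse `s_t` with another successor of `s_{t-1}`. -/
def StepConfusion (P : MarkovSource S) (L : ℕ) (θ₁ : ℝ≥0∞) (s : ℕ → Fin n → S) :
    Set (ℕ → (Fin n → S) → Fin M) :=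
  ⋃ t : Fin (L + 1), {F | ∃ y ∈ {y | y ≠ s (t + 1) ∧ θ₁ ≤ P.blockStep 1 (s t) y},
    F ∈ {F | ∀ _ : Unit, F t y = F t (s (t + 1))}}

/-- The paths over a window that look typical, but differ everywhere from `s`. -/
def confusingWindows (P : MarkovSource S) (W : ℕ) (θ₁ θ₂ : ℝ≥0∞) (s : ℕ → Fin n → S) (j b : ℕ) :
    Set (Fin n → Fin (W + 1) → S) :=
  {y | θ₂ ≤ P.blockStep (b + 1) (s j) (fun k => y k 0) ∧
    (∀ u : Fin W, θ₁ ≤ P.blockStep 1 (fun k => y k u.castSucc) (fun k => y k u.succ)) ∧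
    ∀ u : Fin (W + 1), (fun k => y k u) ≠ s (j + b + 1 + u)}

/-- The binning `F` can confuse the window after some burst with a window that differs from it
everywhere. -/
def WindowConfusion (P : MarkovSource S) (L B W : ℕ) (θ₁ θ₂ : ℝ≥0∞) (s : ℕ → Fin n → S) :
    Set (ℕ → (Fin n → S) → Fin M) :=
  ⋃ jb : Fin (L + 1) × Fin (B + 1), {F | ∃ y ∈ confusingWindows P W θ₁ θ₂ s jb.1 jb.2,
    F ∈ {F | ∀ u : Fin (W + 1), F (jb.1 + jb.2 + u) (fun k => y k u) =
      F (jb.1 + jb.2 + u) (s (jb.1 + jb.2 + 1 + u))}}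

theorem binningMeasure_stepConfusion_le [Countable S] [NeZero M] (P : MarkovSource S) (L : ℕ)
    {θ₁ : ℝ≥0∞} (h0 : θ₁ ≠ 0) (ht : θ₁ ≠ ⊤) (s : ℕ → Fin n → S) :
    binningMeasure (Fin n → S) M (StepConfusion P L θ₁ s) ≤
      (L + 1) * (θ₁⁻¹ * (M : ℝ≥0∞)⁻¹ ^ 1) := by
  refine (MeasureTheory.measure_iUnion_fintype_le _ _).trans ?_
  refine (Finset.sum_le_sum (g := fun _ => θ₁⁻¹ * (M : ℝ≥0∞)⁻¹ ^ 1) fun t _ => ?_).trans ?_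
  · refine measure_exists_le_of_weight _ (prodLaw fun k => P.step 1 (s t k)) _ _ h0 ht
      (fun y hy => hy.2) fun y hy => ?_
    exact binningMeasure_collision_le (ι := Unit) (τ := fun _ => t)
      (fun _ _ _ => rfl) (y := fun _ => y) (y' := fun _ => s (t + 1)) fun _ => hy.1
  · simp

theorem binningMeasure_windowConfusion_le [Countable S] [NeZero M] (P : MarkovSource S)
    (L B W : ℕ) {θ₁ θ₂ : ℝ≥0∞} (h0 : θ₂ * θ₁ ^ W ≠ 0) (ht : θ₂ * θ₁ ^ W ≠ ⊤)
    (s : ℕ → Fin n → S) :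
    binningMeasure (Fin n → S) M (WindowConfusion P L B W θ₁ θ₂ s) ≤
      (L + 1) * (B + 1) * ((θ₂ * θ₁ ^ W)⁻¹ * (M : ℝ≥0∞)⁻¹ ^ (W + 1)) := by
  refine (MeasureTheory.measure_iUnion_fintype_le _ _).trans ?_
  refine (Finset.sum_le_sum (g := fun _ => (θ₂ * θ₁ ^ W)⁻¹ * (M : ℝ≥0∞)⁻¹ ^ (W + 1))
    fun jb _ => ?_).trans ?_
  · refine measure_exists_le_of_weight _
      -- The conditional law of the window given `s_j` gives every confusing window mass at least
      -- `θ₂ * θ₁ ^ W`.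
      (prodLaw fun k => P.pathFrom (P.step (jb.2 + 1) (s jb.1 k)) W) _ _ h0 ht
      (fun y hy => ?_) fun y hy => ?_
    · simp only [prodLaw_apply, MarkovSource.pathFrom_apply, Finset.prod_mul_distrib]
      rw [Finset.prod_comm]
      refine mul_le_mul' hy.1 ?_
      calc θ₁ ^ W = ∏ _u : Fin W, θ₁ := by simp
        _ ≤ _ := Finset.prod_le_prod' fun u _ => by
          have := hy.2.1 u
          simpa only [MarkovSource.blockStep, MarkovSource.step_one] using this
    · have := binningMeasure_collision_le (M := M) (ι := Fin (W + 1))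
        (τ := fun u => jb.1 + jb.2 + u) (fun u v h => by ext; simpa using h)
        (y := fun u k => y k u) (y' := fun u => s (jb.1 + jb.2 + 1 + u)) hy.2.2
      simpa using this
  · simp

/-- The sequences `s_{-1}^n, s_0^n, …` of an outcome, continued arbitrarily. -/
def blockSeq (ω : Fin n → Fin (L + 2) → S) (t : ℕ) : Fin n → S := block ω (Fin.ofNat (L + 2) t)

theorem blockSeq_of_lt (ω : Fin n → Fin (L + 2) → S) {t : ℕ} (h : t < L + 2) :
    blockSeq ω t = block ω ⟨t, h⟩ := by
  rw [blockSeq]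
  congr 1
  ext
  simp [Nat.mod_eq_of_lt h]

/-- All transitions up to time `N` have typical probabilities. -/
def Typical (P : MarkovSource S) (B : ℕ) (θ₁ θ₂ : ℝ≥0∞) (z : ℕ → Fin n → S) (N : ℕ) : Prop :=
  (∀ t ≤ N, θ₁ ≤ P.blockStep 1 (z t) (z (t + 1))) ∧
    ∀ t b, b ≤ B → t + b ≤ N → θ₂ ≤ P.blockStep (b + 1) (z t) (z (t + b + 1))

open Classical in
/-- The code that transmits bin indices and decodes to a typical sequence in the received
bins. -/
def binningCode (P : MarkovSource S) (B : ℕ) (θ₁ θ₂ : ℝ≥0∞) (F : ℕ → (Fin n → S) → Fin M) :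
    Code S n L M where
  enc i past := F i (past (Fin.last (i + 1)))
  dec i g x :=
    if h : ∃ z : ℕ → Fin n → S, z 0 = x ∧ Typical P B θ₁ θ₂ z i ∧
        ∀ t : Fin ((i : ℕ) + 1), ∀ m, g t = some m → m = F t (z (t + 1)) then
      h.choose (i + 1)
    else x

/-- The true sequence is a candidate, so the search succeeds; the candidate chosen may be another
one, but `eq_of_compatible` makes it correct at time `i`. -/
theorem binningCode_reconstruction (P : MarkovSource S) {B W : ℕ} {θ₁ θ₂ : ℝ≥0∞}
    {F : ℕ → (Fin n → S) → Fin M} {ω : Fin n → Fin (L + 2) → S}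
    (htyp : Typical P B θ₁ θ₂ (blockSeq ω) L) (h₁ : F ∉ StepConfusion P L θ₁ (blockSeq ω))
    (h₂ : F ∉ WindowConfusion P L B W θ₁ θ₂ (blockSeq ω)) {j b : ℕ} (hb : b ≤ B)
    (i : Fin (L + 1)) (hij : ¬ (j ≤ (i : ℕ) ∧ (i : ℕ) < j + b + W)) :
    (binningCode P B θ₁ θ₂ F : Code S n L M).reconstruction j b ω i = block ω i.succ := by
  set c : Code S n L M := binningCode P B θ₁ θ₂ F with hc
  have hin : ∀ t : Fin (L + 1), c.channelInput ω t = F t (blockSeq ω (t + 1)) := by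
    intro t
    rw [Code.channelInput_eq (F := fun i => F i) (fun _ _ => rfl), blockSeq_of_lt ω (by omega)]
    rfl
  let g : Fin ((i : ℕ) + 1) → Option (Fin M) := fun t => c.channelOutput j b ω ⟨t, by omega⟩
  have hex : ∃ z : ℕ → Fin n → S, z 0 = block ω 0 ∧ Typical P B θ₁ θ₂ z i ∧
      ∀ t : Fin ((i : ℕ) + 1), ∀ m, g t = some m → m = F t (z (t + 1)) := by
    refine ⟨blockSeq ω, blockSeq_of_lt ω (by omega),
      ⟨fun t ht => htyp.1 t (by omega), fun t b hb ht => htyp.2 t b hb (by omega)⟩,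
      fun t m hm => ?_⟩
    simp only [g, Code.channelOutput] at hm
    split_ifs at hm
    rw [← Option.some.inj hm, hin]
  have hrec : c.reconstruction j b ω i = hex.choose (i + 1) := dif_pos hex
  obtain ⟨hz0, hz, hg⟩ := hex.choose_spec
  rw [hrec]
  refine (eq_of_compatible (F := F) (s := blockSeq ω) (z := hex.choose) (L := L) (B := B) (W := W)
    (K₁ := fun x y => θ₁ ≤ P.blockStep 1 x y) (K₂ := fun b x y => θ₂ ≤ P.blockStep (b + 1) x y)
    ?_ ?_ i.2 hb hij (hz0.trans (blockSeq_of_lt ω (t := 0) (by omega)).symm) hz.1 hz.2 ?_).trans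
    (blockSeq_of_lt ω (by omega))
  · intro t ht y hy hK hF
    exact h₁ (Set.mem_iUnion.2 ⟨⟨t, ht⟩, y, ⟨hy, hK⟩, fun _ => hF⟩)
  · intro j b hb hjb y hK₂ hK₁ hne
    by_contra! hF
    exact h₂ (Set.mem_iUnion.2 ⟨(⟨j, by omega⟩, ⟨b, by omega⟩), fun k u => y u k,
      ⟨hK₂, hK₁, hne⟩, hF⟩)
  · intro t ht hno
    refine (hg ⟨t, by omega⟩ (F t (blockSeq ω (t + 1))) ?_).symm
    simp only [g, Code.channelOutput]
    rw [if_neg hno, hin]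

/-- The confusion events do not depend on the actual burst, so a single binning serves all `j`, `b`
and `i`. -/
theorem exists_binningCode [Countable S] (P : MarkovSource S) (n L M B W : ℕ) [NeZero M]
    {θ₁ θ₂ : ℝ≥0∞} (h₁ : θ₁ ≠ 0) (h₁' : θ₁ ≠ ⊤) (h₂ : θ₂ ≠ 0) (h₂' : θ₂ ≠ ⊤) :
    ∃ c : Code S n L M, c.IsMemoryless ∧ ∀ j b : ℕ, b ≤ B → ∀ i : Fin (L + 1),
      ¬ (j ≤ (i : ℕ) ∧ (i : ℕ) < j + b + W) → c.errorProb P j b i ≤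
        (P.blockLaw n L).toOuterMeasure {ω | ¬ Typical P B θ₁ θ₂ (blockSeq ω) L} +
          ((L + 1) * (θ₁⁻¹ * (M : ℝ≥0∞)⁻¹ ^ 1) +
            (L + 1) * (B + 1) * ((θ₂ * θ₁ ^ W)⁻¹ * (M : ℝ≥0∞)⁻¹ ^ (W + 1))) := by
  obtain ⟨F, hF⟩ := exists_prob_mem_le (binningMeasure (Fin n → S) M) (P.blockLaw n L)
    (fun ω => StepConfusion P L θ₁ (blockSeq ω) ∪ WindowConfusion P L B W θ₁ θ₂ (blockSeq ω))
    (fun ω => (MeasureTheory.measure_union_le _ _).trans (add_le_add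
      (binningMeasure_stepConfusion_le P L h₁ h₁' _)
      (binningMeasure_windowConfusion_le P L B W (mul_ne_zero h₂ (pow_ne_zero _ h₁))
        (ENNReal.mul_ne_top h₂' (ENNReal.pow_ne_top h₁')) _)))
  refine ⟨binningCode P B θ₁ θ₂ F, fun i => ⟨F i, fun _ => rfl⟩, fun j b hb i hij => ?_⟩
  refine le_trans ?_ ((MeasureTheory.measure_union_le _ _).trans (add_le_add_right hF _))
  refine MeasureTheory.measure_mono fun ω hω => ?_
  by_contra h
  rw [Set.mem_union, not_or] at h
  have h2 := h.2
  simp only [Set.mem_ofPred_eq, Set.mem_union, not_or] at h2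
  exact hω (binningCode_reconstruction P (not_not.1 h.1) h2.1 h2.2 hb i hij)

end

/-! ### Asymptotics of the error bound -/

theorem blockLaw_blockStep_lt (P : MarkovSource S) (n L : ℕ) {t m : ℕ} (hm : 1 ≤ m)
    (h : t + m ≤ L + 1) (θ : ℝ≥0∞) :
    (P.blockLaw n L).toOuterMeasure {ω | P.blockStep m (blockSeq ω t) (blockSeq ω (t + m)) < θ} =
      (iidLaw (joint P.marg (P.step m)) n).toOuterMeasure
        {z | ∏ k, P.step m (z k).1 (z k).2 < θ} := by
  rw [← P.pathLaw_map_pair t m (L + 1) hm h, iidLaw_map_apply, MarkovSource.blockLaw]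
  congr 1
  ext ω
  simp only [Set.mem_ofPred_eq, MarkovSource.blockStep]
  rw [blockSeq_of_lt ω (by omega), blockSeq_of_lt ω (by omega)]
  rfl

theorem blockLaw_not_typical_le (P : MarkovSource S) (n L B : ℕ) (θ₁ θ₂ : ℝ≥0∞) :
    (P.blockLaw n L).toOuterMeasure {ω | ¬ Typical P B θ₁ θ₂ (blockSeq ω) L} ≤
      ∑ _t : Fin (L + 1), (iidLaw (joint P.marg (P.step 1)) n).toOuterMeasure
        {z | ∏ k, P.step 1 (z k).1 (z k).2 < θ₁} +
      ∑ tb : Fin (L + 1) × Fin (B + 1),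
        (iidLaw (joint P.marg (P.step (tb.2 + 1))) n).toOuterMeasure
          {z | ∏ k, P.step (tb.2 + 1) (z k).1 (z k).2 < θ₂} := by
  have hsub : {ω | ¬ Typical P B θ₁ θ₂ (blockSeq ω) L} ⊆
      (⋃ t : Fin (L + 1), {ω : Fin n → Fin (L + 2) → S |
        P.blockStep 1 (blockSeq ω t) (blockSeq ω (t + 1)) < θ₁}) ∪
      ⋃ tb : Fin (L + 1) × Fin (B + 1), {ω : Fin n → Fin (L + 2) → S | (tb.1 + tb.2 : ℕ) ≤ L ∧
        P.blockStep (tb.2 + 1) (blockSeq ω tb.1) (blockSeq ω (tb.1 + (tb.2 + 1))) < θ₂} := by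
    intro ω hω
    by_contra h
    rw [Set.mem_union, not_or, Set.mem_iUnion, Set.mem_iUnion, not_exists, not_exists] at h
    refine hω ⟨fun t ht => not_lt.1 (h.1 ⟨t, by omega⟩), fun t b hb htb => not_lt.1 fun hlt => ?_⟩
    exact h.2 (⟨t, by omega⟩, ⟨b, by omega⟩) ⟨htb, hlt⟩
  refine (MeasureTheory.measure_mono hsub).trans ((MeasureTheory.measure_union_le _ _).trans
    (add_le_add ?_ ?_))
  · refine (MeasureTheory.measure_iUnion_fintype_le _ _).trans (Finset.sum_le_sum fun t _ => ?_)
    rw [← blockLaw_blockStep_lt P n L le_rfl (t := t) (by omega)]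
  · refine (MeasureTheory.measure_iUnion_fintype_le _ _).trans (Finset.sum_le_sum fun tb _ => ?_)
    -- Beyond `L` the event is empty; `blockSeq` would wrap around there.
    by_cases htb : (tb.1 + tb.2 : ℕ) ≤ L
    · rw [← blockLaw_blockStep_lt P n L (by omega) (t := tb.1) (by omega)]
      exact MeasureTheory.measure_mono fun ω hω => hω.2
    · simp [htb]

theorem threshold_ne_zero (n : ℕ) (c : ℝ) : threshold n c ≠ 0 := by
  simp [threshold]
  positivity

theorem threshold_ne_top (n : ℕ) (c : ℝ) : threshold n c ≠ ⊤ := ENNReal.ofReal_ne_top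

theorem threshold_mul_pow (n k : ℕ) (c d : ℝ) :
    threshold n d * threshold n c ^ k = threshold n (d + k * c) := by
  rw [threshold, threshold, threshold, ← ENNReal.ofReal_pow (by positivity),
    ← ENNReal.ofReal_mul (by positivity), ← Real.rpow_mul_natCast two_pos.le,
    ← Real.rpow_add two_pos]
  congr 2
  ring

theorem numMessages_ne_zero (n : ℕ) (R : ℝ≥0) : numMessages n R ≠ 0 := by
  rw [numMessages, Ne, Nat.floor_eq_zero, not_lt]
  exact Real.one_le_rpow one_le_two (by positivity)

/-- Rounding down a number that is at least `1` loses at most a factor `2`, which does not affect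
exponents. -/
theorem inv_numMessages_le (n : ℕ) (R : ℝ≥0) :
    (numMessages n R : ℝ≥0∞)⁻¹ ≤ ENNReal.ofReal (2 * 2 ^ (-((n : ℝ) * R))) := by
  have h1 : (1 : ℝ) ≤ numMessages n R := by
    exact_mod_cast Nat.one_le_iff_ne_zero.2 (numMessages_ne_zero n R)
  have h2 : (2 : ℝ) ^ ((n : ℝ) * R) < numMessages n R + 1 := Nat.lt_floor_add_one _
  have h3 : (2 : ℝ) ^ ((n : ℝ) * R) ≤ 2 * numMessages n R := by linarith
  rw [← ENNReal.ofReal_natCast, ← ENNReal.ofReal_inv_of_pos (by linarith)]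
  refine ENNReal.ofReal_le_ofReal ?_
  rw [Real.rpow_neg two_pos.le, inv_le_iff_one_le_mul₀ (by linarith), ← div_eq_mul_inv,
    div_mul_eq_mul_div, one_le_div (by positivity)]
  exact h3

theorem tendsto_inv_threshold_mul (R : ℝ≥0) {k : ℕ} {c : ℝ} (h : c < k * R) :
    Tendsto (fun n : ℕ => (threshold n c)⁻¹ * (numMessages n R : ℝ≥0∞)⁻¹ ^ k) atTop (𝓝 0) := by
  have hlim : Tendsto (fun n : ℕ => (2 : ℝ≥0∞) ^ k *
      ENNReal.ofReal (2 ^ (-(n * (k * R - c)) : ℝ))) atTop (𝓝 0) := by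
    have := ENNReal.Tendsto.const_mul (a := (2 : ℝ≥0∞) ^ k)
      (tendsto_ofReal_two_rpow_neg (sub_pos.2 h)) (Or.inr (by finiteness))
    simpa using this
  refine tendsto_of_tendsto_of_tendsto_of_le_of_le tendsto_const_nhds hlim (fun _ => zero_le)
    fun n => ?_
  calc _ ≤ (threshold n c)⁻¹ * ENNReal.ofReal (2 * 2 ^ (-((n : ℝ) * R))) ^ k := by
        gcongr
        exact inv_numMessages_le n R
    _ = _ := by
        rw [threshold, ← ENNReal.ofReal_inv_of_pos (by positivity),
          ENNReal.ofReal_mul two_pos.le, mul_pow, ENNReal.ofReal_ofNat, mul_left_comm,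
          ← ENNReal.ofReal_pow (by positivity), ← ENNReal.ofReal_mul (by positivity),
          ← Real.rpow_neg two_pos.le, ← Real.rpow_mul_natCast two_pos.le, ← Real.rpow_add two_pos]
        congr 3
        ring

theorem feasible_of_condEntropy_lt [Countable S] (P : MarkovSource S) (L B W : ℕ) {R : ℝ≥0}
    (hR : condEntropy (P.windowLaw B W) < (W + 1) * R) : MemorylessFeasible P L B W R := by
  rw [P.condEntropy_windowLaw] at hR
  have hB : P.stepEntropy (B + 1) ≠ ⊤ := fun h => by simp [h] at hR
  have h1 : P.stepEntropy 1 ≠ ⊤ := ne_top_of_le_ne_top hB (P.stepEntropy_mono (by omega))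
  have h1B : (P.stepEntropy 1).toReal ≤ (P.stepEntropy (B + 1)).toReal :=
    ENNReal.toReal_mono hB (P.stepEntropy_mono (by omega))
  have hR' : (P.stepEntropy (B + 1)).toReal + W * (P.stepEntropy 1).toReal < (W + 1) * R := by
    have := (ENNReal.toReal_lt_toReal (ne_top_of_lt hR) (by finiteness)).2 hR
    rw [ENNReal.toReal_add hB (by finiteness)] at this
    simpa [ENNReal.toReal_add] using this
  -- The window exponent `c₂ + W * c₁` contains the slack `δ` exactly `W + 1` times.
  obtain ⟨δ, hδ, hδ'⟩ : ∃ δ : ℝ, 0 < δ ∧ (W + 1) * δ <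
      (W + 1) * R - ((P.stepEntropy (B + 1)).toReal + W * (P.stepEntropy 1).toReal) := by
    obtain ⟨x, hx0, hx⟩ := exists_between (sub_pos.2 hR')
    refine ⟨x / (W + 1), by positivity, ?_⟩
    rwa [mul_div_cancel₀ x (by positivity : (W : ℝ) + 1 ≠ 0)]
  set c₁ := (P.stepEntropy 1).toReal + δ with hc₁
  set c₂ := (P.stepEntropy (B + 1)).toReal + δ with hc₂
  -- As `c₁ ≤ c₂`, the window condition dominates the single-step one.
  have hc₁R : c₁ < (1 : ℕ) * R := by
    have hW : (0 : ℝ) < W + 1 := by positivity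
    have : (W + 1) * c₁ < (W + 1) * R := by rw [hc₁]; linarith
    simpa using lt_of_mul_lt_mul_left this hW.le
  have hc₂R : c₂ + W * c₁ < (W + 1 : ℕ) * R := by
    push_cast
    rw [hc₁, hc₂]
    linarith
  have : ∀ n, NeZero (numMessages n R) := fun n => ⟨numMessages_ne_zero n R⟩
  choose code hmem herr using fun n => exists_binningCode P n L (numMessages n R) B W
    (threshold_ne_zero n c₁) (threshold_ne_top n c₁) (threshold_ne_zero n c₂)
    (threshold_ne_top n c₂)
  refine ⟨code, fun n => _, hmem, ?_, fun n j b hb i hij => herr n j b hb i hij⟩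
  have hstep : ∀ m ≤ B + 1, ∀ c, (P.stepEntropy m).toReal < c →
      Tendsto (fun n : ℕ => (iidLaw (joint P.marg (P.step m)) n).toOuterMeasure
        {z | ∏ k, P.step m (z k).1 (z k).2 < threshold n c}) atTop (𝓝 0) := fun m hm c hc =>
    tendsto_prob_lt_threshold P.marg (P.step m)
      (ne_top_of_le_ne_top hB (P.stepEntropy_mono hm)) hc
  have htyp : Tendsto (fun n => (P.blockLaw n L).toOuterMeasure
      {ω | ¬ Typical P B (threshold n c₁) (threshold n c₂) (blockSeq ω) L}) atTop (𝓝 0) := by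
    refine tendsto_of_tendsto_of_tendsto_of_le_of_le tendsto_const_nhds ?_ (fun _ => zero_le)
      fun n => blockLaw_not_typical_le P n L B _ _
    rw [show (0 : ℝ≥0∞) = ∑ _t : Fin (L + 1), 0 + ∑ _tb : Fin (L + 1) × Fin (B + 1), 0 by simp]
    refine Tendsto.add (tendsto_finsetSum _ fun t _ => ?_) (tendsto_finsetSum _ fun tb _ => ?_)
    · exact hstep 1 (by omega) c₁ (by rw [hc₁]; linarith)
    -- Monotonicity of `stepEntropy` lets the threshold for bursts of length `B` serve all shorter
    -- ones.
    · refine hstep _ (by omega) c₂ ?_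
      have := ENNReal.toReal_mono hB (P.stepEntropy_mono (show (tb.2 : ℕ) + 1 ≤ B + 1 by omega))
      rw [hc₂]
      linarith
  have hfirst := ENNReal.Tendsto.const_mul (a := (L : ℝ≥0∞) + 1)
    (tendsto_inv_threshold_mul R hc₁R) (Or.inr (by finiteness))
  have hsecond := ENNReal.Tendsto.const_mul (a := ((L : ℝ≥0∞) + 1) * (B + 1))
    (tendsto_inv_threshold_mul R hc₂R) (Or.inr (by finiteness))
  simp only [threshold_mul_pow]
  simpa using htyp.add (hfirst.add hsecond)

end Streaming

end

theorem corollary2 {S : Type*} [Countable S] (P : Streaming.MarkovSource S)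
    (hfin : Streaming.entropy P.marg ≠ ⊤) (hsym : P.IsSymmetric) (B W : ℕ) :
    Tendsto (fun L : ℕ => Streaming.memorylessRate P L B W) atTop
      (𝓝 (Streaming.condEntropy (P.windowLaw B W) / ((W : ℝ≥0∞) + 1))) := by
  refine tendsto_const_nhds.congr' ?_
  filter_upwards [eventually_ge_atTop (B + W)] with L hL
  refine le_antisymm ?_ ?_
  · refine le_iInf₂ fun R hR => ENNReal.div_le_of_le_mul' ?_
    exact Streaming.condEntropy_le_of_feasible P hfin hsym hL hR
  -- Every rate strictly above the claimed value is feasible, which bounds the infimum.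
  · refine le_of_forall_gt_imp_ge_of_dense fun r hr => ?_
    induction r with
    | top => exact le_top
    | coe R =>
      refine iInf₂_le R (Streaming.feasible_of_condEntropy_lt P L B W ?_)
      rwa [ENNReal.div_lt_iff (Or.inl (by simp)) (Or.inl (by finiteness)), mul_comm] at hr
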